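/- \textbf{Theorem.} The full NID principle is derivable, in intuitionistic first-order logic with equality, from the axioms of constructive Zermelo--Fraenkel set theory $\mathbf{CZF}$ together with the presentation axiom and the axiom (scheme) of relativised dependent choice for W-types. Here $\mathbf{CZF}$ has the axioms Extensionality, Pairing, Union and Infinity and the schemes of Set Induction, Bounded ($\Delta_0$) Separation, Strong Collection and Subset Collection, and the three principles are as follows. \emph{Full NID.} A \emph{rule} on a set $X$ is a pair $(a,b)$ of subsets of $X$. If $\mathcal R$ is a set of rules on $X$, then $Y\subseteq X$ is \emph{$\mathcal R$-closed} if for every $(a,b)\in\mathcal R$ with $a\subseteq Y$ the sets $b$ and $Y$ have a common element. The principle says: for every set $X$ and every set $\mathcal R$ of rules on $X$, the class of $\mathcal R$-closed subsets of $X$ is set-generated, that is, there is a set $G$ of $\mathcal R$-closed subsets of $X$ such that for every $\mathcal R$-closed $Y\subseteq X$ and every $x\in Y$ there is $Z\in G$ with $x\in Z\subseteq Y$. \emph{Presentation axiom.} A set $A$ is a \emph{base} if every surjection from a set onto $A$ has a section. The axiom says: every set is the surjective image of a base. \emph{Relativised dependent choice for W-types.} A function $f:B\to A$ is a \emph{base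 map} if $A$ and all fibres $B_a=f^{-1}(a)$, $a\in A$, are bases. Put $P_f(X)=\{(a,t): a\in A,\ t:B_a\to X\}$. The \emph{W-type} of $f$ is the initial $P_f$-algebra, a set $W_f$ with a map $\sup:P_f(W_f)\to W_f$, written $(a,t)\mapsto\sup_a t$. The axiom says: for every base map $f:B\to A$ the W-type $W_f$ exists (as a set), and whenever $X$ is a (definable, with parameters) class and $R_a\subseteq X^{B_a}\times X$ $(a\in A)$ is a (definable, with parameters) family of relations such that for all $a\in A$ and $t:B_a\to X$ there is $x\in X$ with $(t,x)\in R_a$, there is a function $h:W_f\to X$ such that $(h\circ t,\,h(\sup_a t))\in R_a$ for every $\sup_a t\in W_f$. -/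

import Mathlib

namespace CZF

/-! ### Formulas and intuitionistic derivability -/

/-- Formulas of the first-order language of set theory, with equality. Variables are de Bruijn
indices: under a quantifier, `0` is the variable it binds and `n + 1` is the outer variable `n`.
There are no function symbols, so variables are the only terms. -/
inductive Fml : Type
  | bot : Fml
  | mem : ℕ → ℕ → Fml
  | eq : ℕ → ℕ → Fml
  | and : Fml → Fml → Fml
  | or : Fml → Fml → Fml
  | imp : Fml → Fml → Fml
  | all : Fml → Fml
  | ex : Fml → Fml

open Fml

infixr:35 " ⋏ " => Fml.and
infixr:30 " ⋎ " => Fml.or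
infixr:25 " ⟹ " => Fml.imp

/-- `φ ↔ ψ`. -/
def iff (φ ψ : Fml) : Fml := (φ ⟹ ψ) ⋏ (ψ ⟹ φ)

infix:20 " ⟺ " => CZF.iff

/-- A renaming of variables, carried under a quantifier. -/
def up (r : ℕ → ℕ) : ℕ → ℕ
  | 0 => 0
  | n + 1 => r n + 1

/-- Capture-avoiding substitution of variables for free variables. -/
def Fml.rename : Fml → (ℕ → ℕ) → Fml
  | .bot, _ => .bot
  | .mem i j, r => .mem (r i) (r j)
  | .eq i j, r => .eq (r i) (r j)
  | .and φ ψ, r => .and (φ.rename r) (ψ.rename r)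
  | .or φ ψ, r => .or (φ.rename r) (ψ.rename r)
  | .imp φ ψ, r => .imp (φ.rename r) (ψ.rename r)
  | .all φ, r => .all (φ.rename (up r))
  | .ex φ, r => .ex (φ.rename (up r))

/-- Weakening: `φ` seen from below one more quantifier. -/
def Fml.shift (φ : Fml) : Fml := φ.rename Nat.succ

/-- `φ[k/0]`: the variable `0` is replaced by `k` and removed. -/
def Fml.inst (φ : Fml) (k : ℕ) : Fml :=
  φ.rename fun i => match i with
    | 0 => k
    | n + 1 => n

/-- `φ(x₀, …, xₘ₋₁)` for `args = [x₀, …, xₘ₋₁]`: the variables `0, …, m - 1` of `φ` are replaced by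
the `xᵢ`, and the variable `m + n` of `φ` (a parameter) stands for the variable which is called `n`
outside of the `d` quantifiers that surround this occurrence. -/
def Fml.app (φ : Fml) (args : List ℕ) (d : ℕ) : Fml :=
  φ.rename fun i => args.getD i (i - args.length + d)

/-- Natural deduction for intuitionistic first-order logic with equality: `Prov T Γ φ` says that `φ`
is derivable from the axioms `T` and the assumptions `Γ`. The axioms may have free variables, and
since the rules `allI` and `exE` put no condition on `T`, an axiom counts as its universal closure. -/
inductive Prov (T : Set Fml) : List Fml → Fml → Prop
  | ax {Γ φ} : φ ∈ T → Prov T Γ φ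
  | hyp {Γ φ} : φ ∈ Γ → Prov T Γ φ
  | botE {Γ φ} : Prov T Γ bot → Prov T Γ φ
  | andI {Γ φ ψ} : Prov T Γ φ → Prov T Γ ψ → Prov T Γ (φ ⋏ ψ)
  | andE₁ {Γ φ ψ} : Prov T Γ (φ ⋏ ψ) → Prov T Γ φ
  | andE₂ {Γ φ ψ} : Prov T Γ (φ ⋏ ψ) → Prov T Γ ψ
  | orI₁ {Γ φ ψ} : Prov T Γ φ → Prov T Γ (φ ⋎ ψ)
  | orI₂ {Γ φ ψ} : Prov T Γ ψ → Prov T Γ (φ ⋎ ψ)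
  | orE {Γ φ ψ χ} : Prov T Γ (φ ⋎ ψ) → Prov T (φ :: Γ) χ → Prov T (ψ :: Γ) χ → Prov T Γ χ
  | impI {Γ φ ψ} : Prov T (φ :: Γ) ψ → Prov T Γ (φ ⟹ ψ)
  | impE {Γ φ ψ} : Prov T Γ (φ ⟹ ψ) → Prov T Γ φ → Prov T Γ ψ
  | allI {Γ φ} : Prov T (Γ.map Fml.shift) φ → Prov T Γ (all φ)
  | allE {Γ φ} (k : ℕ) : Prov T Γ (all φ) → Prov T Γ (φ.inst k)
  | exI {Γ φ} (k : ℕ) : Prov T Γ (φ.inst k) → Prov T Γ (ex φ)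
  | exE {Γ φ ψ} : Prov T Γ (ex φ) → Prov T (φ :: Γ.map Fml.shift) ψ.shift → Prov T Γ ψ
  | eqI {Γ} (i : ℕ) : Prov T Γ (eq i i)
  | eqE {Γ} {φ : Fml} {i j : ℕ} : Prov T Γ (eq i j) → Prov T Γ (φ.inst i) → Prov T Γ (φ.inst j)

/-! ### Basic set-theoretic vocabulary

In all the abbreviations that follow, the arguments of type `ℕ` are variables. -/

/-- `∀ x ∈ a, φ`. -/
def ball (a : ℕ) (φ : Fml) : Fml := all (mem 0 (a + 1) ⟹ φ)

/-- `∃ x ∈ a, φ`. -/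
def bex (a : ℕ) (φ : Fml) : Fml := ex (mem 0 (a + 1) ⋏ φ)

/-- The bounded (`Δ₀`) formulas: every quantifier is of the form `∀ x ∈ a` or `∃ x ∈ a`. -/
inductive Bounded : Fml → Prop
  | bot : Bounded bot
  | mem (i j : ℕ) : Bounded (mem i j)
  | eq (i j : ℕ) : Bounded (eq i j)
  | and {φ ψ} : Bounded φ → Bounded ψ → Bounded (φ ⋏ ψ)
  | or {φ ψ} : Bounded φ → Bounded ψ → Bounded (φ ⋎ ψ)
  | imp {φ ψ} : Bounded φ → Bounded ψ → Bounded (φ ⟹ ψ)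
  | ball (a : ℕ) {φ} : Bounded φ → Bounded (ball a φ)
  | bex (a : ℕ) {φ} : Bounded φ → Bounded (bex a φ)

/-- `a ⊆ b`. -/
def isSub (a b : ℕ) : Fml := ball a (mem 0 (b + 1))

/-- `a = ∅`. -/
def isEmpty (a : ℕ) : Fml := ball a bot

/-- `b = a ∪ {a}`. -/
def isSucc (b a : ℕ) : Fml :=
  isSub a b ⋏ mem a b ⋏ ball b (mem 0 (a + 1) ⋎ eq 0 (a + 1))

/-- `p = {x, y}`. -/
def isUPair (p x y : ℕ) : Fml :=
  mem x p ⋏ mem y p ⋏ ball p (eq 0 (x + 1) ⋎ eq 0 (y + 1))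

/-- `p = ⟨x, y⟩`, that is, `p = {{x}, {x, y}}`. -/
def isOPair (p x y : ℕ) : Fml :=
  bex p (bex (p + 1)
    (isUPair 1 (x + 2) (x + 2) ⋏ isUPair 0 (x + 2) (y + 2) ⋏ isUPair (p + 2) 1 0))

/-- `⟨x, y⟩ ∈ r`. -/
def pairMem (x y r : ℕ) : Fml := bex r (isOPair 0 (x + 1) (y + 1))

/-- `f` is a function from the set `a` to the set `b`, as a set of ordered pairs. -/
def isFun (f a b : ℕ) : Fml :=
  -- every `p ∈ f` is `⟨x, y⟩` for some `x ∈ a`, `y ∈ b`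
  ball f (bex (a + 1) (bex (b + 2) (isOPair 2 1 0))) ⋏
  -- for every `x ∈ a` there is a unique `y ∈ b` with `⟨x, y⟩ ∈ f`
  ball a (bex (b + 1) (pairMem 1 0 (f + 2) ⋏ ball (b + 2) (pairMem 2 0 (f + 3) ⟹ eq 0 1)))

/-- `f` is a surjective function from the set `a` onto the set `b`. -/
def isSurj (f a b : ℕ) : Fml := isFun f a b ⋏ ball b (bex (a + 1) (pairMem 0 1 (f + 2)))

/-- `v` is the composite `g ∘ u` of functions: `v = {⟨b, y⟩ : ∃ x, ⟨b, x⟩ ∈ u ∧ ⟨x, y⟩ ∈ g}`. -/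
def isComp (v g u : ℕ) : Fml :=
  -- below the quantifiers: `p = 3`, `b = 2`, `x = 1`, `y = 0`
  all (mem 0 (v + 1) ⟺
    ex (ex (ex (isOPair 3 2 0 ⋏ pairMem 2 1 (u + 4) ⋏ pairMem 1 0 (g + 4)))))

/-- `t` is a function from the set `a` to the class `{x : φ(x)}`. As in `Fml.app`, `d` is the number of
quantifiers between the parameters of `φ` and this occurrence. -/
def isFunInto (t a : ℕ) (φ : Fml) (d : ℕ) : Fml :=
  -- every `p ∈ t` is `⟨x, y⟩` for some `x ∈ a` and some `y` with `φ(y)`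
  ball t (bex (a + 1) (ex (isOPair 2 1 0 ⋏ φ.app [0] (d + 3)))) ⋏
  -- for every `x ∈ a` there is a unique `y` with `⟨x, y⟩ ∈ t`
  ball a (ex (pairMem 1 0 (t + 2) ⋏ all (pairMem 2 0 (t + 3) ⟹ eq 0 1)))

/-! ### The axioms of CZF -/

/-- `∀ a b, (∀ x, x ∈ a ↔ x ∈ b) → a = b`. -/
def extensionality : Fml := all (all (all (mem 0 2 ⟺ mem 0 1) ⟹ eq 1 0))

/-- `∀ a b, ∃ c, ∀ x, x ∈ c ↔ x = a ∨ x = b`. -/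
def pairing : Fml := all (all (ex (all (mem 0 1 ⟺ (eq 0 3 ⋎ eq 0 2)))))

/-- `∀ a, ∃ b, ∀ x, x ∈ b ↔ ∃ y ∈ a, x ∈ y`. -/
def union : Fml := all (ex (all (mem 0 1 ⟺ bex 2 (mem 1 0))))

/-- `∃ a, ∀ x, x ∈ a ↔ x = ∅ ∨ ∃ y ∈ a, x = y ∪ {y}`. -/
def infinity : Fml := ex (all (mem 0 1 ⟺ (isEmpty 0 ⋎ bex 1 (isSucc 1 0))))

/-- `(∀ a, (∀ x ∈ a, φ(x)) → φ(a)) → ∀ a, φ(a)`. -/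
def setInduction (φ : Fml) : Fml :=
  all (ball 0 (φ.app [0] 2) ⟹ φ.app [0] 1) ⟹ all (φ.app [0] 1)

/-- `∀ a, ∃ b, ∀ x, x ∈ b ↔ x ∈ a ∧ φ(x)`. -/
def separation (φ : Fml) : Fml := all (ex (all (mem 0 1 ⟺ (mem 0 2 ⋏ φ.app [0] 3))))

/-- `∀ a, (∀ x ∈ a, ∃ y, φ(x, y)) →
      ∃ b, (∀ x ∈ a, ∃ y ∈ b, φ(x, y)) ∧ ∀ y ∈ b, ∃ x ∈ a, φ(x, y)`. -/
def strongCollection (φ : Fml) : Fml :=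
  all (ball 0 (ex (φ.app [1, 0] 3)) ⟹
    ex (ball 1 (bex 1 (φ.app [1, 0] 4)) ⋏ ball 0 (bex 2 (φ.app [0, 1] 4))))

/-- `∀ a b, ∃ c, ∀ z, (∀ x ∈ a, ∃ y ∈ b, φ(x, y, z)) →
      ∃ d ∈ c, (∀ x ∈ a, ∃ y ∈ d, φ(x, y, z)) ∧ ∀ y ∈ d, ∃ x ∈ a, φ(x, y, z)`. -/
def subsetCollection (φ : Fml) : Fml :=
  -- `a = 3`, `b = 2`, `c = 1`, `z = 0`, and below `∃ d` these are `4`, `3`, `2`, `1` with `d = 0`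
  all (all (ex (all (
    ball 3 (bex 3 (φ.app [1, 0, 2] 6)) ⟹
      bex 1 (ball 4 (bex 1 (φ.app [1, 0, 3] 7)) ⋏ ball 0 (bex 5 (φ.app [0, 1, 3] 7)))))))

/-- The axioms of constructive Zermelo-Fraenkel set theory CZF. -/
inductive IsAxiomCZF : Fml → Prop
  | extensionality : IsAxiomCZF extensionality
  | pairing : IsAxiomCZF pairing
  | union : IsAxiomCZF union
  | infinity : IsAxiomCZF infinity
  | setInduction (φ : Fml) : IsAxiomCZF (setInduction φ)
  | boundedSeparation (φ : Fml) : Bounded φ → IsAxiomCZF (separation φ)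
  | strongCollection (φ : Fml) : IsAxiomCZF (strongCollection φ)
  | subsetCollection (φ : Fml) : IsAxiomCZF (subsetCollection φ)

/-! ### The presentation axiom -/

/-- The set `a` is a base: every surjection `f : x → a` from a set `x` has a section `s`. -/
def isBase (a : ℕ) : Fml :=
  -- `x = 1`, `f = 0`, and below `∃ s` these are `2`, `1` with `s = 0`
  all (all (isSurj 0 1 (a + 2) ⟹
    ex (isFun 0 (a + 3) 2 ⋏ ball (a + 3) (ball 3 (pairMem 1 0 2 ⟹ pairMem 0 1 3)))))

/-- Every set is the surjective image of a base. -/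
def presentationAxiom : Fml := all (ex (isBase 0 ⋏ ex (isSurj 0 1 2)))

/-! ### W-types and relativised dependent choice -/

/-- `F` is the fibre `f⁻¹(a) = {b ∈ B : f(b) = a}` of `f : B → A`. -/
def isFibre (F f B a : ℕ) : Fml :=
  ball F (mem 0 (B + 1) ⋏ pairMem 0 (a + 1) (f + 1)) ⋏
  ball B (pairMem 0 (a + 1) (f + 1) ⟹ mem 0 (F + 1))

/-- `f : B → A` is a base map: its codomain `A` and all its fibres are bases. -/
def isBaseMap (f B A : ℕ) : Fml :=
  isFun f B A ⋏ isBase A ⋏ ball A (all (isFibre 0 (f + 2) (B + 2) 1 ⟹ isBase 0))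

/-- `P = P_f(X) = {⟨a, t⟩ : a ∈ A, t : f⁻¹(a) → X}`, for `f : B → A`. -/
def isPoly (P f B A X : ℕ) : Fml :=
  -- below the quantifiers: `p = 3`, `a = 2`, `F = 1` (the fibre), `t = 0`
  all (mem 0 (P + 1) ⟺
    bex (A + 1) (ex (ex (isFibre 1 (f + 4) (B + 4) 2 ⋏ isFun 0 1 (X + 4) ⋏ isOPair 3 2 0))))

/-- `(X, s)` is a `P_f`-algebra, that is, `s` is a function `P_f(X) → X`. -/
def isAlg (X s f B A : ℕ) : Fml :=
  ex (isPoly 0 (f + 1) (B + 1) (A + 1) (X + 1) ⋏ isFun (s + 1) 0 (X + 1))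

/-- `s(a, u) = x`, that is, `⟨⟨a, u⟩, x⟩ ∈ s`. -/
def algVal (s a u x : ℕ) : Fml :=
  ex (isOPair 0 (a + 1) (u + 1) ⋏ pairMem 0 (x + 1) (s + 1))

/-- `α : X → Y` is a morphism of `P_f`-algebras from `(X, s)` to `(Y, t)`:
`α(s(a, u)) = t(a, α ∘ u)`. -/
def isMor (α X s Y t : ℕ) : Fml :=
  isFun α X Y ⋏
  -- if `s(a, u) = x`, `v = α ∘ u` and `t(a, v) = y`, then `α(x) = y`;
  -- below the quantifiers: `a = 4`, `u = 3`, `x = 2`, `v = 1`, `y = 0`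
  all (all (all (all (all (
    algVal (s + 5) 4 3 2 ⟹ isComp 1 (α + 5) 3 ⟹ algVal (t + 5) 4 1 0 ⟹
      pairMem 2 0 (α + 5))))))

/-- `(W, s)` is the W-type associated to `f : B → A`: it is an initial `P_f`-algebra. -/
def isWType (W s f B A : ℕ) : Fml :=
  isAlg W s f B A ⋏
  -- for every `P_f`-algebra `(X, t) = (1, 0)` there is a unique morphism from `(W, s)` to it
  all (all (isAlg 1 0 (f + 2) (B + 2) (A + 2) ⟹
    ex (isMor 0 (W + 3) (s + 3) 2 1 ⋏ all (isMor 0 (W + 4) (s + 4) 3 2 ⟹ eq 0 1))))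

/-- Every base map has a W-type. -/
def baseWTypesExist : Fml :=
  all (all (all (isBaseMap 0 1 2 ⟹ ex (ex (isWType 1 0 2 3 4)))))

/-- Dependent choice along the W-type `(W, sup)` of a base map `f : B → A`, for the class
`X = {x : φ(x)}` and the relations `R_a = {(t, x) : ρ(a, t, x)}` between `X^(f⁻¹(a))` and `X`: if
`R_a` is total for every `a ∈ A`, then there is a function `h : W → X` with
`(h ∘ u, h(sup_a u)) ∈ R_a` for every `sup_a u ∈ W`. -/
def relativisedWChoice (φ ρ : Fml) : Fml :=
  -- `A = 4`, `B = 3`, `f = 2`, `W = 1`, `sup = 0`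
  all (all (all (all (all (isBaseMap 2 3 4 ⟹ isWType 1 0 2 3 4 ⟹
    -- totality: `a = 2`, `F = 1` (the fibre), `t = 0`; below `∃ x`, `x = 0`, `t = 1`, `a = 3`
    ball 4 (all (all (isFibre 1 5 6 2 ⟹ isFunInto 0 1 φ 8 ⟹
      ex (φ.app [0] 9 ⋏ ρ.app [3, 1, 0] 9)))) ⟹
    -- if `sup(a, u) = w`, `v = h ∘ u` and `h(w) = y`, then `ρ(a, v, y)`;
    -- below the quantifiers: `h = 5`, `sup = 6`, `a = 4`, `u = 3`, `w = 2`, `v = 1`, `y = 0`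
    ex (isFunInto 0 2 φ 6 ⋏
      all (all (all (all (all (
        algVal 6 4 3 2 ⟹ isComp 1 5 3 ⟹ pairMem 2 0 5 ⟹ ρ.app [4, 1, 0] 11)))))))))))

/-- The axiom (scheme) of relativised dependent choice for W-types: every base map has a W-type, and
dependent choice holds along it for arbitrary classes. -/
inductive IsAxiomRDCW : Fml → Prop
  | exist : IsAxiomRDCW baseWTypesExist
  | choice (φ ρ : Fml) : IsAxiomRDCW (relativisedWChoice φ ρ)

/-! ### Non-deterministic inductive definitions -/

/-- `R` is a set of rules on `X`: a set of pairs `⟨a, b⟩` of subsets of `X`. -/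
def isRuleSet (R X : ℕ) : Fml :=
  ball R (ex (ex (isOPair 2 1 0 ⋏ isSub 1 (X + 3) ⋏ isSub 0 (X + 3))))

/-- `Y` is an `R`-closed subset of `X`: for every rule `⟨a, b⟩ ∈ R`, if `a ⊆ Y` then `b` and `Y` have
an element in common. -/
def isClosed (Y R X : ℕ) : Fml :=
  isSub Y X ⋏
  all (all (pairMem 1 0 (R + 2) ⟹ isSub 1 (Y + 2) ⟹ bex 0 (mem 0 (Y + 3))))

/-- The (full) NID principle: for every set `X` and every set `R` of rules on `X`, the class of
`R`-closed subsets of `X` is set-generated, that is, there is a set `G` of `R`-closed subsets of `X`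
such that for every `R`-closed `Y ⊆ X` and every `x ∈ Y` there is `Z ∈ G` with `x ∈ Z ⊆ Y`. -/
def nid : Fml :=
  -- `X = 1`, `R = 0`, and below `∃ G` these are `2`, `1` with `G = 0`
  all (all (isRuleSet 0 1 ⟹
    ex (ball 0 (isClosed 0 2 3) ⋏
      all (isClosed 0 2 3 ⟹ ball 0 (bex 2 (mem 1 0 ⋏ isSub 0 2))))))

/-- CZF together with the presentation axiom and relativised dependent choice for W-types. -/
def CZFPlusPAPlusRDCW : Set Fml :=
  {χ | IsAxiomCZF χ ∨ χ = presentationAxiom ∨ IsAxiomRDCW χ}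

end CZF

namespace CZF

open Fml

/-! ### Renamings -/

/-! It suffices to find, for every rule set `R` on `X`, a set of closed sets such that each closed
`Y` has a subset in it (`ex_coinitial`). Adding the rule `⟨∅, {x}⟩` restricts attention to closed
sets containing `x`, and Strong Collection over `x ∈ X` assembles the generating set
(`setGenerated`).

For coinitiality, the presentation axiom gives a base map `f : B → A` such that every premise of a
rule is the image of a fibre of `f` (`exists_cover`). Let `W` be its W-type. Inside a closed `Y`,
build subsets `h(w) ⊆ Y` along `W` so that `h(sup_α u)` meets the conclusion of each rule whose
premise lies in the union of the sets `h(u(p))`. Then `Z = ⋃ h(w)` is closed (`wtype_union_closed`):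
if a premise `a ⊆ Z` is covered by the fibre over `α`, choice over that fibre yields `t` from it to
`W` with `a ⊆ ⋃ h(t(p))`, so `h(sup_α t) ⊆ Z` already meets the conclusion.

To obtain a set of such `Z` independent of `Y`, the values of `h` must come from a fixed set `K`.
Subset Collection supplies enough subsets for one given `U` and all closed `Y ⊇ U` at once
(`ex_supply`). A first dependent choice along `W` closes this under unions of families indexed by
fibres and gives `K` (`exists_supply`). A second one, for each `Y`, picks `h : W → K`.
Exponentiation then bounds all these `h`. Initiality of `W` enters only through the choice scheme.

The derivation is carried out in the formal calculus. Object variables are numbers of the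
metalanguage, and eigenvariable conditions become quantification over all numbers (`allI'`, `exE'`).
Existence lemmas are stated with a continuation that receives the witness in an extended context. -/

theorem up_comp (r s : ℕ → ℕ) : up s ∘ up r = up (s ∘ r) := by
  funext i; cases i <;> rfl

theorem up_id : up id = id := by
  funext i; cases i <;> rfl

theorem Fml.rename_rename (φ : Fml) (r s : ℕ → ℕ) :
    (φ.rename r).rename s = φ.rename (s ∘ r) := by
  induction φ generalizing r s <;> simp_all [Fml.rename, up_comp]

theorem Fml.rename_id (φ : Fml) : φ.rename id = φ := by
  induction φ <;> simp_all [Fml.rename, up_id]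

/-- Only finitely many variables are free in a formula. -/
theorem Fml.exists_bound (φ : Fml) :
    ∃ n, ∀ r s : ℕ → ℕ, (∀ i < n, r i = s i) → φ.rename r = φ.rename s := by
  have up_agree {n : ℕ} {r s : ℕ → ℕ} (h : ∀ i < n - 1, r i = s i) :
      ∀ i < n, up r i = up s i := by
    intro i hi
    cases i with
    | zero => rfl
    | succ i => simp only [up, h i (by omega)]
  have two {φ ψ : Fml} (op : Fml → Fml → Fml)
      (hop : ∀ φ ψ r, (op φ ψ).rename r = op (φ.rename r) (ψ.rename r))
      (h₁ : ∃ n, ∀ r s : ℕ → ℕ, (∀ i < n, r i = s i) → φ.rename r = φ.rename s)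
      (h₂ : ∃ n, ∀ r s : ℕ → ℕ, (∀ i < n, r i = s i) → ψ.rename r = ψ.rename s) :
      ∃ n, ∀ r s : ℕ → ℕ, (∀ i < n, r i = s i) → (op φ ψ).rename r = (op φ ψ).rename s := by
    obtain ⟨n, hn⟩ := h₁
    obtain ⟨m, hm⟩ := h₂
    refine ⟨max n m, fun r s h => ?_⟩
    rw [hop, hop, hn r s fun i hi => h i (by omega), hm r s fun i hi => h i (by omega)]
  induction φ with
  | bot => exact ⟨0, fun _ _ _ => rfl⟩
  | mem i j =>
    exact ⟨i + j + 1, fun r s h => by simp only [rename, h i (by omega), h j (by omega)]⟩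
  | eq i j =>
    exact ⟨i + j + 1, fun r s h => by simp only [rename, h i (by omega), h j (by omega)]⟩
  | and φ ψ h₁ h₂ => exact two .and (fun _ _ _ => rfl) h₁ h₂
  | or φ ψ h₁ h₂ => exact two .or (fun _ _ _ => rfl) h₁ h₂
  | imp φ ψ h₁ h₂ => exact two .imp (fun _ _ _ => rfl) h₁ h₂
  | all φ h =>
    obtain ⟨n, hn⟩ := h
    exact ⟨n - 1, fun r s h => by simp only [rename, hn _ _ (up_agree h)]⟩
  | ex φ h =>
    obtain ⟨n, hn⟩ := h
    exact ⟨n - 1, fun r s h => by simp only [rename, hn _ _ (up_agree h)]⟩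

theorem exists_bound_list (Γ : List Fml) :
    ∃ n, ∀ φ ∈ Γ, ∀ r s : ℕ → ℕ, (∀ i < n, r i = s i) → φ.rename r = φ.rename s := by
  induction Γ with
  | nil => exact ⟨0, by simp⟩
  | cons ψ Γ ih =>
    obtain ⟨n, hn⟩ := ih
    obtain ⟨m, hm⟩ := ψ.exists_bound
    refine ⟨max n m, fun φ hφ r s h => ?_⟩
    rcases List.mem_cons.1 hφ with rfl | hφ
    · exact hm r s fun i hi => h i (by omega)
    · exact hn φ hφ r s fun i hi => h i (by omega)

theorem Fml.inst_rename (φ : Fml) (k : ℕ) (r : ℕ → ℕ) :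
    (φ.inst k).rename r = (φ.rename (up r)).inst (r k) := by
  unfold Fml.inst
  rw [rename_rename, rename_rename]
  congr 1
  funext i; cases i <;> rfl

theorem Fml.shift_rename (φ : Fml) (r : ℕ → ℕ) :
    φ.shift.rename (up r) = (φ.rename r).shift := by
  unfold Fml.shift
  rw [rename_rename, rename_rename]
  rfl

theorem map_shift_rename (Γ : List Fml) (r : ℕ → ℕ) :
    (Γ.map Fml.shift).map (·.rename (up r)) = (Γ.map (·.rename r)).map Fml.shift := by
  simp [shift_rename]

/-! ### Structural rules -/

namespace Prov

variable {T : Set Fml} {Γ Δ : List Fml} {φ ψ χ : Fml}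

theorem weaken (h : Prov T Γ φ) (hΓ : Γ ⊆ Δ) : Prov T Δ φ := by
  induction h generalizing Δ with
  | ax h => exact ax h
  | hyp h => exact hyp (hΓ h)
  | botE _ ih => exact botE (ih hΓ)
  | andI _ _ ih₁ ih₂ => exact andI (ih₁ hΓ) (ih₂ hΓ)
  | andE₁ _ ih => exact andE₁ (ih hΓ)
  | andE₂ _ ih => exact andE₂ (ih hΓ)
  | orI₁ _ ih => exact orI₁ (ih hΓ)
  | orI₂ _ ih => exact orI₂ (ih hΓ)
  | orE _ _ _ ih ih₁ ih₂ =>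
    exact orE (ih hΓ) (ih₁ (List.cons_subset_cons _ hΓ)) (ih₂ (List.cons_subset_cons _ hΓ))
  | impI _ ih => exact impI (ih (List.cons_subset_cons _ hΓ))
  | impE _ _ ih₁ ih₂ => exact impE (ih₁ hΓ) (ih₂ hΓ)
  | allI _ ih => exact allI (ih (List.map_subset _ hΓ))
  | allE k _ ih => exact allE k (ih hΓ)
  | exI k _ ih => exact exI k (ih hΓ)
  | exE _ _ ih₁ ih₂ =>
    exact exE (ih₁ hΓ) (ih₂ (List.cons_subset_cons _ (List.map_subset _ hΓ)))
  | eqI i => exact eqI i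
  | eqE _ _ ih₁ ih₂ => exact eqE (ih₁ hΓ) (ih₂ hΓ)

/-- The axiom set need not be closed under renaming, but in the empty context a variable can be
generalised and instantiated at will. Doing this `n` times replaces the first `n` variables; a
formula has finitely many free variables, so this yields every renaming. -/
theorem rename_lt (n : ℕ) (k : ℕ → ℕ) (h : Prov T [] φ) :
    Prov T [] (φ.rename fun i => if i < n then k i else i - n) := by
  induction n generalizing φ k with
  | zero =>
    have h' : Prov T [] (φ.rename id) := φ.rename_id.symm ▸ h
    simp only [Nat.not_lt_zero, if_false, Nat.sub_zero]
    exact h'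
  | succ n ih =>
    -- The offset `n` protects `k 0`: the remaining `n` replacements leave `k 0 + n` alone and lower
    -- it to `k 0`.
    have h' := ih (fun i => k (i + 1)) (allE (k 0 + n) (allI (Γ := []) h))
    rw [Fml.inst, Fml.rename_rename] at h'
    convert h' using 2
    funext i
    cases i with
    | zero => simp
    | succ i => simp

theorem rename_nil (h : Prov T [] φ) (r : ℕ → ℕ) : Prov T [] (φ.rename r) := by
  obtain ⟨n, hn⟩ := φ.exists_bound
  rw [hn r (fun i => if i < n then r i else i - n) fun i hi => (if_pos hi).symm]
  exact rename_lt n r h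

theorem rename (h : Prov T Γ φ) (r : ℕ → ℕ) :
    Prov T (Γ.map (·.rename r)) (φ.rename r) := by
  induction h generalizing r with
  | ax h => exact (rename_nil (ax h) r).weaken (List.nil_subset _)
  | hyp h => exact hyp (List.mem_map_of_mem h)
  | botE _ ih => exact botE (ih r)
  | andI _ _ ih₁ ih₂ => exact andI (ih₁ r) (ih₂ r)
  | andE₁ _ ih => exact andE₁ (ih r)
  | andE₂ _ ih => exact andE₂ (ih r)
  | orI₁ _ ih => exact orI₁ (ih r)
  | orI₂ _ ih => exact orI₂ (ih r)
  | orE _ _ _ ih ih₁ ih₂ => exact orE (ih r) (ih₁ r) (ih₂ r)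
  | impI _ ih => exact impI (ih r)
  | impE _ _ ih₁ ih₂ => exact impE (ih₁ r) (ih₂ r)
  | allI _ ih => exact allI (map_shift_rename _ r ▸ ih (up r))
  | allE k _ ih => rw [Fml.inst_rename]; exact allE _ (ih r)
  | exI k _ ih => exact exI (r k) (Fml.inst_rename _ k r ▸ ih r)
  | exE _ _ ih₁ ih₂ =>
    have h := ih₂ (up r)
    rw [List.map_cons, map_shift_rename, Fml.shift_rename] at h
    exact exE (ih₁ r) h
  | eqI i => exact eqI _
  | eqE _ _ ih₁ ih₂ =>
    rw [Fml.inst_rename]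
    exact eqE (ih₁ r) (Fml.inst_rename _ _ r ▸ ih₂ r)

/-- A renaming that turns the variable `n` into the variable `0` of a new quantifier. -/
theorem map_rename_fresh {n : ℕ}
    (hn : ∀ φ ∈ Γ, ∀ r s : ℕ → ℕ, (∀ i < n, r i = s i) → φ.rename r = φ.rename s) :
    Γ.map (·.rename fun i => if i = n then 0 else i + 1) = Γ.map Fml.shift := by
  refine List.map_congr_left fun φ hφ => hn φ hφ _ _ fun i hi => ?_
  simp [hi.ne]

theorem inst_rename_fresh {n : ℕ}
    (hn : ∀ r s : ℕ → ℕ, (∀ i < n, r i = s i) → (all φ).rename r = (all φ).rename s) :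
    (φ.inst n).rename (fun i => if i = n then 0 else i + 1) = φ := by
  rw [Fml.inst, rename_rename]
  have h := hn (fun i => if i = n then 0 else i) id fun i hi => by simp [hi.ne]
  rw [rename_id] at h
  simp only [Fml.rename, all.injEq] at h
  -- Since `n` is not free in `all φ`, the variable `n + 1` of `φ` may be moved to `n + 2`. This
  -- removes the only index at which instantiating by `n` and renaming back could collide.
  have h' := hn (fun i => if i = n then i + 1 else i) id fun i hi => by simp [hi.ne]
  rw [rename_id] at h'
  simp only [Fml.rename, all.injEq] at h'
  conv_rhs => rw [← h']
  conv_lhs => rw [← h']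
  rw [rename_rename]
  congr 1
  funext i
  cases i with
  | zero => simp [up]
  | succ i => by_cases hi : i = n <;> simp [up, hi]

/-- The introduction rule for `∀` with a variable of the metalanguage. -/
theorem allI' (h : ∀ k, Prov T Γ (φ.inst k)) : Prov T Γ (all φ) := by
  obtain ⟨n, hn⟩ := exists_bound_list (all φ :: Γ)
  have h' := (h n).rename fun i => if i = n then 0 else i + 1
  rw [map_rename_fresh fun ψ hψ => hn ψ (List.mem_cons_of_mem _ hψ),
    inst_rename_fresh (hn _ List.mem_cons_self)] at h'
  exact allI h'

theorem impI' (h : Prov T (φ :: Γ) φ → Prov T (φ :: Γ) ψ) : Prov T Γ (φ ⟹ ψ) :=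
  impI (h (hyp List.mem_cons_self))

theorem exE' (h : Prov T Γ (ex φ))
    (h' : ∀ k, Prov T (φ.inst k :: Γ) (φ.inst k) → Prov T (φ.inst k :: Γ) χ) : Prov T Γ χ := by
  -- The family of derivations, one for each witness, is internalised as a single universal
  -- implication, which the primitive rule can use with its own eigenvariable.
  have key : Prov T Γ (all (φ ⟹ χ.shift)) := allI' fun k => by
    have e : χ.shift.inst k = χ := by
      unfold Fml.inst Fml.shift
      rw [rename_rename]
      exact χ.rename_id
    change Prov T Γ (φ.inst k ⟹ χ.shift.inst k)
    rw [e]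
    exact impI' (h' k)
  refine exE h (impE ?_ (hyp List.mem_cons_self))
  have h₁ := allE 0 ((key.rename Nat.succ).weaken
    (List.subset_cons_self φ (Γ.map (·.rename Nat.succ))))
  have e : ((φ ⟹ χ.shift).rename (up Nat.succ)).inst 0 = (φ ⟹ χ.shift) := by
    unfold Fml.inst
    rw [rename_rename]
    conv_rhs => rw [← rename_id (φ ⟹ χ.shift)]
    congr 1
    funext i; cases i <;> rfl
  rw [e] at h₁
  exact h₁

end Prov

/-! ### Natural deduction with named hypotheses -/

/-- The context `Δ` extends the context `Γ`. -/
class Ext (Γ Δ : List Fml) : Prop where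
  subset : Γ ⊆ Δ

instance (priority := 50) Ext.refl (Γ : List Fml) : Ext Γ Γ := ⟨List.Subset.refl _⟩

instance (priority := 100) Ext.cons (Γ Δ : List Fml) (φ : Fml) [h : Ext Γ Δ] : Ext Γ (φ :: Δ) :=
  ⟨List.subset_cons_of_subset _ h.subset⟩

/-- The context `Δ` is introduced as an extension of the context `Γ`. -/
class Step (Γ : outParam (List Fml)) (Δ : List Fml) : Prop where
  subset : Γ ⊆ Δ

theorem Step.of {Γ Δ : List Fml} [h : Ext Γ Δ] : Step Γ Δ := ⟨h.subset⟩

/-- Search strips formulas off the context first, then crosses a `Step`, whose output parameter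
recovers the smaller context, and tries reflexivity last. -/
instance (priority := 75) Ext.step (Γ Δ Δ' : List Fml) [h' : Step Δ Δ'] [h : Ext Γ Δ] :
    Ext Γ Δ' :=
  ⟨List.Subset.trans h.subset h'.subset⟩

infix:15 " ⊩ " => Prov CZFPlusPAPlusRDCW

namespace Prov

variable {Γ Δ : List Fml} {φ ψ χ : Fml} {a b c i j k x y : ℕ}

/-- Weakening to an extended context. -/
theorem m [h : Ext Γ Δ] (d : Γ ⊩ φ) : Δ ⊩ φ := d.weaken h.subset

theorem mp (d : Γ ⊩ φ ⟹ ψ) (e : Γ ⊩ φ) : Γ ⊩ ψ := impE d e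

theorem orE' (d : Γ ⊩ φ ⋎ ψ) (d₁ : (φ :: Γ ⊩ φ) → (φ :: Γ ⊩ χ))
    (d₂ : (ψ :: Γ ⊩ ψ) → (ψ :: Γ ⊩ χ)) : Γ ⊩ χ :=
  orE d (d₁ (hyp List.mem_cons_self)) (d₂ (hyp List.mem_cons_self))

/-- The new assumption is abstracted as `θ`, so that contexts stay small; only its two consequences
are handed on. -/
theorem exE₂ (d : Γ ⊩ ex (φ ⋏ ψ))
    (d' : ∀ k θ, (θ :: Γ ⊩ φ.inst k) → (θ :: Γ ⊩ ψ.inst k) → (θ :: Γ ⊩ χ)) : Γ ⊩ χ :=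
  exE' d fun k h => d' k _ (andE₁ h) (andE₂ h)

theorem iffI (d₁ : (φ :: Γ ⊩ φ) → (φ :: Γ ⊩ ψ)) (d₂ : (ψ :: Γ ⊩ ψ) → (ψ :: Γ ⊩ φ)) :
    Γ ⊩ φ ⟺ ψ :=
  andI (impI' d₁) (impI' d₂)

theorem iffMp (d : Γ ⊩ φ ⟺ ψ) (e : Γ ⊩ φ) : Γ ⊩ ψ := impE (andE₁ d) e

theorem iffMpr (d : Γ ⊩ φ ⟺ ψ) (e : Γ ⊩ ψ) : Γ ⊩ φ := impE (andE₂ d) e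

/-! Bounded quantifiers -/

theorem ballI (d : ∀ x, (mem x a :: Γ ⊩ mem x a) → (mem x a :: Γ ⊩ φ.inst x)) : Γ ⊩ ball a φ :=
  allI' fun x => impI' (d x)

theorem ballE (d : Γ ⊩ ball a φ) (e : Γ ⊩ mem x a) : Γ ⊩ φ.inst x := impE (allE x d) e

theorem bexI (e : Γ ⊩ mem x a) (d : Γ ⊩ φ.inst x) : Γ ⊩ bex a φ := exI x (andI e d)

theorem bexE (d : Γ ⊩ bex a φ)
    (d' : ∀ x θ, (θ :: Γ ⊩ mem x a) → (θ :: Γ ⊩ φ.inst x) → (θ :: Γ ⊩ χ)) : Γ ⊩ χ :=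
  exE₂ d d'

/-! Equality -/

/-- Replacement of equals in the formula `φ`, at the variable `0`. -/
theorem subst (φ : Fml) (e : Γ ⊩ eq i j) (d : Γ ⊩ φ.inst i) : Γ ⊩ φ.inst j := eqE e d

theorem symm (e : Γ ⊩ eq i j) : Γ ⊩ eq j i := e.subst (eq 0 (i + 1)) (eqI i)

theorem trans (e : Γ ⊩ eq i j) (e' : Γ ⊩ eq j k) : Γ ⊩ eq i k := e'.subst (eq (i + 1) 0) e

theorem mem_left (e : Γ ⊩ eq i j) (d : Γ ⊩ mem i a) : Γ ⊩ mem j a := e.subst (mem 0 (a + 1)) d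

theorem mem_right (e : Γ ⊩ eq i j) (d : Γ ⊩ mem a i) : Γ ⊩ mem a j := e.subst (mem (a + 1) 0) d

theorem subI (d : ∀ x, (mem x a :: Γ ⊩ mem x a) → (mem x a :: Γ ⊩ mem x b)) : Γ ⊩ isSub a b :=
  ballI d

theorem subE (d : Γ ⊩ isSub a b) (e : Γ ⊩ mem x a) : Γ ⊩ mem x b := ballE d e

theorem sub_trans (d : Γ ⊩ isSub a b) (e : Γ ⊩ isSub b c) : Γ ⊩ isSub a c :=
  subI fun _ hx => e.m.subE (d.m.subE hx)

end Prov

open Prov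

variable {Γ Δ : List Fml} {φ ψ χ : Fml}
  {A B C D E F G K P R S U V W X Y Z a b c e f g h p q r s t u v w x y z x' y' α σ : ℕ}

theorem prov_czf (h : IsAxiomCZF φ) : Γ ⊩ φ := Prov.ax (Or.inl h)

/-! ### Sets from the axioms of CZF -/

theorem Prov.ext (h₁ : Γ ⊩ isSub a b) (h₂ : Γ ⊩ isSub b a) : Γ ⊩ eq a b := by
  have h : Γ ⊩ all (mem 0 (a + 1) ⟺ mem 0 (b + 1)) ⟹ eq a b :=
    allE b (allE a (prov_czf .extensionality))
  exact h.mp (allI' fun x => iffI (fun hx => h₁.m.subE hx) (fun hx => h₂.m.subE hx))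

theorem exists_upair (x y : ℕ)
    (h : ∀ p θ, (θ :: Γ ⊩ isUPair p x y) → (θ :: Γ ⊩ χ)) : Γ ⊩ χ := by
  have h₀ : Γ ⊩ ex (all (mem 0 1 ⟺ (eq 0 (x + 2) ⋎ eq 0 (y + 2)))) :=
    allE y (allE x (prov_czf .pairing))
  refine exE' h₀ fun p hp => h p _ ?_
  have hp (z) : _ :: Γ ⊩ mem z p ⟺ (eq z x ⋎ eq z y) := allE z hp
  exact andI ((hp x).iffMpr (orI₁ (eqI x))) <| andI ((hp y).iffMpr (orI₂ (eqI y))) <|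
    ballI fun z hz => iffMp (φ := mem z p) (ψ := eq z x ⋎ eq z y) (hp z).m hz

theorem exists_union (a : ℕ)
    (h : ∀ b θ, (∀ x, θ :: Γ ⊩ mem x b ⟺ bex a (mem (x + 1) 0)) → (θ :: Γ ⊩ χ)) : Γ ⊩ χ := by
  have h₀ : Γ ⊩ ex (all (mem 0 1 ⟺ bex (a + 2) (mem 1 0))) := allE a (prov_czf .union)
  exact exE' h₀ fun b hb => h b _ fun x => allE x hb

theorem Fml.app_rename (φ : Fml) (l : List ℕ) (d : ℕ) (r : ℕ → ℕ) :
    (φ.app l d).rename r = φ.rename fun i => r (l.getD i (i - l.length + d)) :=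
  φ.rename_rename _ _

theorem exists_sep (φ : Fml) (hφ : Bounded φ) (a : ℕ)
    (h : ∀ b θ, (∀ x, θ :: Γ ⊩ mem x b ⟺ (mem x a ⋏ φ.inst x)) → (θ :: Γ ⊩ χ)) : Γ ⊩ χ := by
  have h₀ := allE (Γ := Γ) a (prov_czf (.boundedSeparation φ hφ))
  refine exE' h₀ fun b hb => h b _ fun x => ?_
  have h₁ := allE x hb
  have e : (((φ.app [0] 3).rename (up (up (fun i => match i with | 0 => a | n + 1 => n)))).rename
      (up (fun i => match i with | 0 => b | n + 1 => n))).inst x = φ.inst x := by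
    unfold Fml.inst
    rw [app_rename, rename_rename, rename_rename]
    congr 1
    funext i; cases i <;> rfl
  rw [← e]
  exact h₁

/-! ### Ordered pairs -/

theorem upair_left (h : Γ ⊩ isUPair p x y) : Γ ⊩ mem x p := andE₁ h

theorem upair_right (h : Γ ⊩ isUPair p x y) : Γ ⊩ mem y p := andE₁ (andE₂ h)

theorem upair_mem (h : Γ ⊩ isUPair p x y) (hz : Γ ⊩ mem z p) : Γ ⊩ eq z x ⋎ eq z y :=
  ballE (andE₂ (andE₂ h)) hz

theorem upair_sub (h : Γ ⊩ isUPair p x y) (hx : Γ ⊩ mem x a) (hy : Γ ⊩ mem y a) :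
    Γ ⊩ isSub p a :=
  subI fun _ hz => orE' (upair_mem h.m hz) (fun e => e.symm.mem_left hx.m)
    (fun e => e.symm.mem_left hy.m)

theorem upair_unique (h : Γ ⊩ isUPair p x y) (h' : Γ ⊩ isUPair q x y) : Γ ⊩ eq p q :=
  Prov.ext (upair_sub h (upair_left h') (upair_right h'))
    (upair_sub h' (upair_left h) (upair_right h))

theorem single_mem (h : Γ ⊩ isUPair p x x) (hz : Γ ⊩ mem z p) : Γ ⊩ eq z x :=
  orE' (upair_mem h hz) id id

theorem opairI (hu : Γ ⊩ isUPair u x x) (hv : Γ ⊩ isUPair v x y) (hp : Γ ⊩ isUPair p u v) :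
    Γ ⊩ isOPair p x y :=
  bexI (upair_left hp) (bexI (upair_right hp) (andI hu (andI hv hp)))

theorem opairE (h : Γ ⊩ isOPair p x y)
    (k : ∀ u v θ θ', (θ' :: θ :: Γ ⊩ isUPair u x x) → (θ' :: θ :: Γ ⊩ isUPair v x y) →
      (θ' :: θ :: Γ ⊩ isUPair p u v) → (θ' :: θ :: Γ ⊩ χ)) : Γ ⊩ χ :=
  h.bexE fun u θ _ h' => h'.bexE fun v θ' _ h'' =>
    k u v θ θ' (andE₁ h'') (andE₁ (andE₂ h'')) (andE₂ (andE₂ h''))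

theorem ex_opair (x y : ℕ) : Γ ⊩ ex (isOPair 0 (x + 1) (y + 1)) :=
  exists_upair x x fun u _ hu => exists_upair x y fun v _ hv => exists_upair u v fun p _ hp =>
    exI p (opairI hu.m hv.m hp)

theorem exists_opair (x y : ℕ) (h : ∀ p θ, (θ :: Γ ⊩ isOPair p x y) → (θ :: Γ ⊩ χ)) : Γ ⊩ χ :=
  exE' (ex_opair x y) fun p hp => h p _ hp

theorem opair_congr (h : Γ ⊩ isOPair p x y) (e : Γ ⊩ eq p q) : Γ ⊩ isOPair q x y :=
  e.subst (isOPair 0 (x + 1) (y + 1)) h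

theorem opair_congr_left (h : Γ ⊩ isOPair p x y) (e : Γ ⊩ eq x z) : Γ ⊩ isOPair p z y :=
  e.subst (isOPair (p + 1) 0 (y + 1)) h

theorem opair_congr_right (h : Γ ⊩ isOPair p x y) (e : Γ ⊩ eq y z) : Γ ⊩ isOPair p x z :=
  e.subst (isOPair (p + 1) (x + 1) 0) h

theorem opair_unique (h : Γ ⊩ isOPair p x y) (h' : Γ ⊩ isOPair q x y) : Γ ⊩ eq p q :=
  opairE h fun u _ _ _ hu hv hp => opairE h'.m fun _ v' _ _ hu' hv' hp' =>
    upair_unique hp.m <| (upair_unique hv' hv.m).subst (isUPair (q + 1) (u + 1) 0) <|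
      (upair_unique hu' hu.m).subst (isUPair (q + 1) 0 (v' + 1)) hp'

theorem opair_fst_mem (h : Γ ⊩ isOPair p x y) (hu : Γ ⊩ mem u p) : Γ ⊩ mem x u :=
  opairE h fun _ _ _ _ hv hw hp => orE' (upair_mem hp hu.m)
    (fun e => e.symm.mem_right (upair_left hv).m) (fun e => e.symm.mem_right (upair_left hw).m)

theorem opair_mem_mem (h : Γ ⊩ isOPair p x y) (hu : Γ ⊩ mem u p) (hz : Γ ⊩ mem z u) :
    Γ ⊩ eq z x ⋎ eq z y :=
  opairE h fun _ _ _ _ hv hw hp => orE' (upair_mem hp hu.m)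
    (fun e => orI₁ (single_mem hv.m (e.mem_right hz.m)))
    (fun e => upair_mem hw.m (e.mem_right hz.m))

/-- The first component belongs to every element of a Kuratowski pair, and one of these elements is
`{x'}`. -/
theorem opair_fst (h : Γ ⊩ isOPair p x y) (h' : Γ ⊩ isOPair p x' y') : Γ ⊩ eq x x' :=
  opairE h' fun _ _ _ _ hu _ hp => single_mem hu (opair_fst_mem h.m (upair_left hp))

theorem opair_snd (h : Γ ⊩ isOPair p x y) (h' : Γ ⊩ isOPair p x' y') : Γ ⊩ eq y y' := by
  have hx := opair_fst h h'
  have key {x y x' y'} (h : Γ ⊩ isOPair p x y) (h' : Γ ⊩ isOPair p x' y') :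
      Γ ⊩ eq y x' ⋎ eq y y' :=
    opairE h fun _ _ _ _ _ hv hp => opair_mem_mem h'.m (upair_right hp) (upair_right hv)
  -- If `y = x'`, the symmetric disjunction gives `y' = x`, whence `y = x' = x = y'`, or `y' = y`.
  -- No case distinction on `x = y` is needed.
  refine orE' (key h h') (fun e => ?_) id
  exact orE' (key h' h).m (fun e' => e.m.trans (hx.symm.m.trans e'.symm)) (fun e' => e'.symm)

theorem pairMemI (hp : Γ ⊩ mem p r) (h : Γ ⊩ isOPair p x y) : Γ ⊩ pairMem x y r := bexI hp h

theorem pairMemE (h : Γ ⊩ pairMem x y r)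
    (k : ∀ p θ, (θ :: Γ ⊩ mem p r) → (θ :: Γ ⊩ isOPair p x y) → (θ :: Γ ⊩ χ)) : Γ ⊩ χ :=
  h.bexE k

theorem pairMem_mem (h : Γ ⊩ pairMem x y r) (hp : Γ ⊩ isOPair p x y) : Γ ⊩ mem p r :=
  pairMemE h fun _ _ hq hqp => (opair_unique hqp hp.m).mem_left hq

theorem pairMem_congr_left (h : Γ ⊩ pairMem x y r) (e : Γ ⊩ eq x z) : Γ ⊩ pairMem z y r :=
  e.subst (pairMem 0 (y + 1) (r + 1)) h

theorem pairMem_congr_right (h : Γ ⊩ pairMem x y r) (e : Γ ⊩ eq y z) : Γ ⊩ pairMem x z r :=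
  e.subst (pairMem (x + 1) 0 (r + 1)) h

/-! ### Functions -/

theorem fun_pair (h : Γ ⊩ isFun f a b) (hp : Γ ⊩ mem p f)
    (k : ∀ x y θ θ', (θ' :: θ :: Γ ⊩ mem x a) → (θ' :: θ :: Γ ⊩ mem y b) →
      (θ' :: θ :: Γ ⊩ isOPair p x y) → (θ' :: θ :: Γ ⊩ χ)) : Γ ⊩ χ :=
  ((andE₁ h).ballE hp).bexE fun x θ hx h' => h'.bexE fun y θ' hy h'' => k x y θ θ' hx.m hy h''

theorem fun_dom (h : Γ ⊩ isFun f a b) (hxy : Γ ⊩ pairMem x y f) : Γ ⊩ mem x a :=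
  pairMemE hxy fun _ _ hp hpx => fun_pair h.m hp fun _ _ _ _ hx _ hpx' =>
    (opair_fst hpx' hpx.m).mem_left hx

theorem fun_cod (h : Γ ⊩ isFun f a b) (hxy : Γ ⊩ pairMem x y f) : Γ ⊩ mem y b :=
  pairMemE hxy fun _ _ hp hpx => fun_pair h.m hp fun _ _ _ _ _ hy hpx' =>
    (opair_snd hpx' hpx.m).mem_left hy

theorem fun_total (h : Γ ⊩ isFun f a b) (hx : Γ ⊩ mem x a)
    (k : ∀ y θ, (θ :: Γ ⊩ pairMem x y f) → (θ :: Γ ⊩ χ)) : Γ ⊩ χ :=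
  ((andE₂ h).ballE hx).bexE fun y θ _ h' => k y θ (andE₁ h')

theorem fun_unique (h : Γ ⊩ isFun f a b) (hy : Γ ⊩ pairMem x y f) (hz : Γ ⊩ pairMem x z f) :
    Γ ⊩ eq y z := by
  refine ((andE₂ h).ballE (fun_dom h hy)).bexE fun w θ _ h' => ?_
  have hw {v : ℕ} (hv : Γ ⊩ pairMem x v f) : θ :: Γ ⊩ eq v w := by
    have h₁ : θ :: Γ ⊩ pairMem x v f ⟹ eq v w := (andE₂ h').ballE (fun_cod h hv).m
    exact h₁.mp hv.m
  exact (hw hy).trans (hw hz).symm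

theorem funI (hp : ∀ p, Γ ⊩ mem p f ⟹ ex (ex (isOPair (p + 2) 1 0)))
    (hd : ∀ x y, Γ ⊩ pairMem x y f ⟹ mem x a) (hc : ∀ x y, Γ ⊩ pairMem x y f ⟹ mem y b)
    (ht : ∀ x, Γ ⊩ mem x a ⟹ ex (pairMem (x + 1) 0 (f + 1)))
    (hu : ∀ x y z, Γ ⊩ pairMem x y f ⟹ pairMem x z f ⟹ eq z y) : Γ ⊩ isFun f a b := by
  refine andI (ballI fun p h => ?_) (ballI fun x hx => ?_)
  · refine exE' ((hp p).m.mp h) fun x h' => exE' h' fun y hxy => ?_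
    have hm := pairMemI h.m hxy
    exact bexI ((hd x y).m.mp hm) (bexI ((hc x y).m.mp hm) hxy)
  · refine exE' ((ht x).m.mp hx) fun y hxy => ?_
    exact bexI ((hc x y).m.mp hxy) <| andI hxy <| ballI fun z _ => impI' fun hz =>
      ((hu x y z).m.mp hxy.m).mp hz

theorem surjI (h : Γ ⊩ isFun f a b) (hs : ∀ y, Γ ⊩ mem y b ⟹ ex (pairMem 0 (y + 1) (f + 1))) :
    Γ ⊩ isSurj f a b :=
  andI h <| ballI fun y hy => exE' ((hs y).m.mp hy) fun _ hxy => bexI (fun_dom h.m hxy) hxy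

theorem surj_fun (h : Γ ⊩ isSurj f a b) : Γ ⊩ isFun f a b := andE₁ h

theorem surjE (h : Γ ⊩ isSurj f a b) (hy : Γ ⊩ mem y b)
    (k : ∀ x θ, (θ :: Γ ⊩ pairMem x y f) → (θ :: Γ ⊩ χ)) : Γ ⊩ χ :=
  ((andE₂ h).ballE hy).bexE fun x θ _ h' => k x θ h'

/-! ### Collection -/

/-- Instances of axiom schemes contain composite renamings of the schematic formula. They are
compared index by index: one case per argument, and a last case for all parameters. -/
theorem Fml.app_rename_eq {φ : Fml} {l l' : List ℕ} {d d' : ℕ} {r : ℕ → ℕ}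
    (h : ∀ i, r (l.getD i (i - l.length + d)) = l'.getD i (i - l'.length + d')) :
    (φ.app l d).rename r = φ.app l' d' := by
  rw [app_rename, funext h, app]

theorem Fml.app_rename_rename_eq {φ : Fml} {l l' : List ℕ} {d d' : ℕ} {r r' : ℕ → ℕ}
    (h : ∀ i, r' (r (l.getD i (i - l.length + d))) = l'.getD i (i - l'.length + d')) :
    ((φ.app l d).rename r).rename r' = φ.app l' d' := by
  rw [rename_rename]
  exact app_rename_eq h

/-- In `φ`, here and in the lemmas on graphs and functions below, `0` is the input, `1` the output,
and the outer variable `n` is written `n + 2`. -/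
theorem exists_collection (φ : Fml) (a : ℕ)
    (h : ∀ x, Γ ⊩ mem x a ⟹ ex (φ.app [x + 1, 0] 1))
    (k : ∀ b θ, (∀ x, θ :: Γ ⊩ mem x a ⟹ bex b (φ.app [x + 1, 0] 1)) →
      (∀ y, θ :: Γ ⊩ mem y b ⟹ bex a (φ.app [0, y + 1] 1)) → (θ :: Γ ⊩ χ)) : Γ ⊩ χ := by
  have h₀ : Γ ⊩ ball a (ex (φ.app [1, 0] 2)) ⟹
      ex (ball (a + 1) (bex 1 (φ.app [1, 0] 3)) ⋏ ball 0 (bex (a + 2) (φ.app [0, 1] 3))) := by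
    convert allE (Γ := Γ) a (prov_czf (.strongCollection φ)) using 1
    simp only [Fml.inst, Fml.rename, ball, bex, up]
    congr <;> exact (app_rename_eq (by rintro (_ | _ | _) <;> rfl)).symm
  have e₁ (x) : (ex (φ.app [1, 0] 2)).inst x = ex (φ.app [x + 1, 0] 1) :=
    congrArg ex (app_rename_eq (by rintro (_ | _ | _) <;> rfl))
  refine exE₂ (h₀.mp (ballI fun x hx => e₁ x ▸ (h x).m.mp hx)) fun b θ h₁ h₂ => k b θ ?_ ?_
  · intro x
    refine impI' fun hx => ?_
    have h₃ := h₁.m.ballE hx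
    have e : ((bex 1 (φ.app [1, 0] 3)).rename (up fun i => match i with | 0 => b | n + 1 => n)).inst
        x = bex b (φ.app [x + 1, 0] 1) :=
      congrArg (fun ψ => ex (mem 0 (b + 1) ⋏ ψ))
        (app_rename_rename_eq (by rintro (_ | _ | _) <;> rfl))
    exact e ▸ h₃
  · intro y
    refine impI' fun hy => ?_
    have h₃ := ballE (a := b) h₂.m hy
    have e : ((bex (a + 2) (φ.app [0, 1] 3)).rename
        (up fun i => match i with | 0 => b | n + 1 => n)).inst y = bex a (φ.app [0, y + 1] 1) :=
      congrArg (fun ψ => ex (mem 0 (a + 1) ⋏ ψ))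
        (app_rename_rename_eq (by rintro (_ | _ | _) <;> rfl))
    exact e ▸ h₃

theorem app_congr_left (h : Γ ⊩ φ.app [x, y] 0) (e : Γ ⊩ eq x z) : Γ ⊩ φ.app [z, y] 0 := by
  have e' (w) : (φ.app [0, y + 1] 1).inst w = φ.app [w, y] 0 :=
    app_rename_eq (by rintro (_ | _ | _) <;> rfl)
  exact e' z ▸ e.subst (φ.app [0, y + 1] 1) (e' x ▸ h)

theorem app_congr_right (h : Γ ⊩ φ.app [x, y] 0) (e : Γ ⊩ eq y z) : Γ ⊩ φ.app [x, z] 0 := by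
  have e' (w) : (φ.app [x + 1, 0] 1).inst w = φ.app [x, w] 0 :=
    app_rename_eq (by rintro (_ | _ | _) <;> rfl)
  exact e' z ▸ e.subst (φ.app [x + 1, 0] 1) (e' y ▸ h)

/-- A total relation on a set contains a set of pairs that is total. -/
theorem exists_graph (φ : Fml) (a : ℕ) (h : ∀ x, Γ ⊩ mem x a ⟹ ex (φ.app [x + 1, 0] 1))
    (k : ∀ f θ, (∀ p, θ :: Γ ⊩ mem p f ⟹ ex (ex (isOPair (p + 2) 1 0))) →
      (∀ x y, θ :: Γ ⊩ pairMem x y f ⟹ mem x a ⋏ φ.app [x, y] 0) →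
      (∀ x, θ :: Γ ⊩ mem x a ⟹ ex (pairMem (x + 1) 0 (f + 1))) → (θ :: Γ ⊩ χ)) : Γ ⊩ χ := by
  have e (x p) : (ex (isOPair 2 1 0 ⋏ φ.app [1, 0] 3)).app [x, p] 0 =
      ex (isOPair (p + 1) (x + 1) 0 ⋏ φ.app [x + 1, 0] 1) := by
    refine congrArg (fun ψ => ex (_ ⋏ ψ)) (app_rename_eq ?_)
    rintro (_ | _ | _) <;> rfl
  have e' (x y) : (φ.app [x + 1, 0] 1).inst y = φ.app [x, y] 0 :=
    app_rename_eq (by rintro (_ | _ | _) <;> rfl)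
  have hl (x p) : ((ex (isOPair 2 1 0 ⋏ φ.app [1, 0] 3)).app [x + 1, 0] 1).inst p =
      ex (isOPair (p + 1) (x + 1) 0 ⋏ φ.app [x + 1, 0] 1) :=
    (app_rename_eq (by rintro (_ | _ | _) <;> rfl)).trans (e x p)
  have hr (x p) : ((ex (isOPair 2 1 0 ⋏ φ.app [1, 0] 3)).app [0, p + 1] 1).inst x =
      ex (isOPair (p + 1) (x + 1) 0 ⋏ φ.app [x + 1, 0] 1) :=
    (app_rename_eq (by rintro (_ | _ | _) <;> rfl)).trans (e x p)
  refine exists_collection (ex (isOPair 2 1 0 ⋏ φ.app [1, 0] 3)) a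
    (fun x => impI' fun hx => exE' ((h x).m.mp hx) fun y hy => ?_) fun f θ h₁ h₂ => k f θ ?_ ?_ ?_
  · refine exists_opair x y fun p _ hp => exI p ?_
    rw [hl]
    exact exI y (andI hp hy.m)
  · refine fun p => impI' fun hp => ((h₂ p).m.mp hp).bexE fun x _ _ h' => ?_
    rw [hr] at h'
    exact exE₂ h' fun y _ h₃ _ => exI x (exI y h₃)
  · refine fun x y => impI' fun hxy => pairMemE hxy fun p _ hp hpx => ?_
    refine ((h₂ p).m.mp hp).bexE fun x' _ hx' h' => ?_
    rw [hr] at h'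
    refine exE₂ h' fun y' _ h₃ h₄ => ?_
    have h₅ := opair_fst h₃ hpx.m
    rw [e'] at h₄
    exact andI (h₅.mem_left hx'.m) (app_congr_right (app_congr_left h₄ h₅)
      (opair_snd h₃ hpx.m))
  · refine fun x => impI' fun hx => ((h₁ x).m.mp hx).bexE fun p _ hp h' => ?_
    rw [hl] at h'
    exact exE₂ h' fun y _ h₃ _ => exI y (pairMemI hp.m h₃)

/-- A definable operation on a set is a function. -/
theorem exists_fun (φ : Fml) (a b : ℕ) (h : ∀ x, Γ ⊩ mem x a ⟹ ex (φ.app [x + 1, 0] 1))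
    (hc : ∀ x y, Γ ⊩ mem x a ⟹ φ.app [x, y] 0 ⟹ mem y b)
    (hu : ∀ x y z, Γ ⊩ mem x a ⟹ φ.app [x, y] 0 ⟹ φ.app [x, z] 0 ⟹ eq z y)
    (k : ∀ f θ, (θ :: Γ ⊩ isFun f a b) → (∀ x y, θ :: Γ ⊩ pairMem x y f ⟹ φ.app [x, y] 0) →
      (∀ x y, θ :: Γ ⊩ mem x a ⟹ φ.app [x, y] 0 ⟹ pairMem x y f) → (θ :: Γ ⊩ χ)) :
    Γ ⊩ χ := by
  refine exists_graph φ a h fun f θ h₁ h₂ h₃ => k f θ ?_ ?_ ?_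
  · refine funI h₁ (fun x y => impI' fun h => andE₁ ((h₂ x y).m.mp h))
      (fun x y => impI' fun h => ?_) h₃ (fun x y z => impI' fun hy => impI' fun hz => ?_)
    · have h' := mp (h₂ x y).m h
      exact ((hc x y).m.mp (andE₁ h')).mp (andE₂ h')
    · have hy : pairMem x z f :: pairMem x y f :: θ :: Γ ⊩ _ := mp (h₂ x y).m hy.m
      have hz := mp (h₂ x z).m hz
      exact (((hu x y z).m.mp (andE₁ hy)).mp (andE₂ hy)).mp (andE₂ hz)
  · exact fun x y => impI' fun h => andE₂ ((h₂ x y).m.mp h)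
  · refine fun x y => impI' fun hx => impI' fun hy => ?_
    refine exE' ((h₃ x).m.mp hx.m) fun z hz => ?_
    have hz' := mp (h₂ x z).m hz
    exact pairMem_congr_right hz ((((hu x y z).m.mp (andE₁ hz')).mp hy.m).mp (andE₂ hz')).m

/-- In `φ`, the variables `0`, `1`, `2` are `x`, `y` and the parameter `z` over which `c` is
uniform; the outer variable `n` is `n + 3`. -/
theorem exists_subset_collection (φ : Fml) (a b : ℕ)
    (k : ∀ c θ, (∀ z, θ :: Γ ⊩ ball a (bex (b + 1) (φ.app [1, 0, z + 2] 2)) ⟹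
      bex c (ball (a + 1) (bex 1 (φ.app [1, 0, z + 3] 3)) ⋏
        ball 0 (bex (a + 2) (φ.app [0, 1, z + 3] 3)))) → (θ :: Γ ⊩ χ)) : Γ ⊩ χ := by
  have h₀ : Γ ⊩ ex (all (ball (a + 2) (bex (b + 3) (φ.app [1, 0, 2] 4)) ⟹
      bex 1 (ball (a + 3) (bex 1 (φ.app [1, 0, 3] 5)) ⋏
        ball 0 (bex (a + 4) (φ.app [0, 1, 3] 5))))) := by
    have h := allE (Γ := Γ) b (allE a (prov_czf (.subsetCollection φ)))
    simp only [Fml.inst, Fml.rename, ball, bex, up] at h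
    rw [app_rename_rename_eq (l := [1, 0, 2]) (l' := [1, 0, 2]) (d' := 4),
      app_rename_rename_eq (l := [1, 0, 3]) (l' := [1, 0, 3]) (d' := 5),
      app_rename_rename_eq (l := [0, 1, 3]) (l' := [0, 1, 3]) (d' := 5)] at h
    · exact h
    all_goals rintro (_ | _ | _ | _) <;> rfl
  refine exE' h₀ fun c hc => k c _ fun z => ?_
  have h := allE z hc
  simp only [Fml.rename, ball, bex, up] at h
  unfold Fml.inst at h
  simp only [Fml.rename, up] at h
  rw [app_rename_rename_eq (l := [1, 0, 2]) (l' := [1, 0, z + 2]) (d' := 2),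
    app_rename_rename_eq (l := [1, 0, 3]) (l' := [1, 0, z + 3]) (d' := 3),
    app_rename_rename_eq (l := [0, 1, 3]) (l' := [0, 1, z + 3]) (d' := 3)] at h
  · exact h
  all_goals rintro (_ | _ | _ | _) <;> rfl

/-! ### Products and exponentials -/

/-- The cartesian product of two sets is contained in a set. -/
theorem exists_prod (a b : ℕ) (k : ∀ P Δ, Step Γ Δ → (∀ p x y,
    Δ ⊩ mem x a ⟹ mem y b ⟹ isOPair p x y ⟹ mem p P) → (Δ ⊩ χ)) : Γ ⊩ χ := by
  -- For each `x` some set contains all `⟨x, y⟩` with `y ∈ b`; such sets are collected over `x ∈ a`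
  -- and united.
  refine exists_collection (ball (b + 2) (bex 2 (isOPair 0 2 1))) a (fun x => impI' fun hx => ?_)
    fun c θ h₁ _ => exists_union c fun P θ' hP => k P _ .of fun p x y =>
      impI' fun hx => impI' fun hy => impI' fun hp => ?_
  · refine exists_collection (isOPair 1 (x + 2) 0) b (fun y => impI' fun _ => ex_opair x y)
      fun c _ h₁ _ => exI c (ballI fun y hy => (h₁ y).m.mp hy)
  · refine ((h₁ x).m.mp hx.m).bexE fun Q _ hQ h₂ => ?_
    refine bexE (h₂.ballE hy.m) fun q _ hq hqp => ?_
    exact (opair_unique hqp hp.m).mem_left ((hP q).m.iffMpr (bexI hQ.m hq))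

/-- The functions from a set to a set form a set. -/
theorem exists_exp (a b : ℕ) (k : ∀ E Δ, Step Γ Δ → (∀ f, Δ ⊩ isFun f a b ⟹ mem f E) → (Δ ⊩ χ)) :
    Γ ⊩ χ := by
  refine exists_prod a b fun P Δ _ hP =>
    exists_subset_collection (mem 1 2 ⋏ ex (isOPair 2 1 0)) a P fun c θ hc =>
      k c _ .of fun f => impI' fun hf => ?_
  -- Subset Collection, with parameter `f`, gives a `d ⊆ f` containing a pair over every `x ∈ a`. As
  -- `f` is single-valued, `d = f`.
  refine bexE ((hc f).m.mp (ballI fun x hx => fun_total hf.m hx fun y _ hy =>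
    pairMemE hy fun p _ hp hpx => ?_)) fun d _ hd h => ?_
  · exact bexI (mp (mp (mp (hP p x y).m hx.m) (fun_cod hf.m hy.m)) hpx) (andI hp (exI y hpx))
  · refine mem_left (Prov.ext (subI fun p hp => ?_) (subI fun p hp => ?_)) hd
    · exact bexE ((andE₂ h).m.ballE hp) fun x _ _ h' => andE₁ h'
    · refine fun_pair hf.m hp fun x y _ _ hx _ hpx => ?_
      refine bexE ((andE₁ h).m.ballE hx) fun q _ hq h' => exE' (andE₂ h') fun y' hqx => ?_
      have hy : _ ⊩ eq y' y := fun_unique hf.m (pairMemI (andE₁ h').m hqx) (pairMemI hp.m hpx.m)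
      exact (opair_unique (opair_congr_right hqx hy) hpx.m).mem_left hq.m

/-! ### Functions into a class -/

theorem into_pair (ht : Γ ⊩ isFunInto t a φ 0) (hp : Γ ⊩ mem p t)
    (k : ∀ x y Δ, Step Γ Δ → (Δ ⊩ mem x a) → (Δ ⊩ isOPair p x y) → (Δ ⊩ φ.app [y] 0) → (Δ ⊩ χ)) :
    Γ ⊩ χ := by
  refine ((andE₁ ht).ballE hp).bexE fun x θ hx h' => exE₂ h' fun y θ' h₁ h₂ =>
    k x y _ .of hx.m h₁ ?_
  unfold Fml.inst at h₂
  rw [app_rename_rename_eq (l := [0]) (l' := [0]) (d' := 1) (r' := up _),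
    app_rename_eq (l' := [y]) (d' := 0)] at h₂
  · exact h₂
  all_goals rintro (_ | _) <;> rfl

theorem app_congr (h : Γ ⊩ φ.app [y] 0) (e : Γ ⊩ eq y z) : Γ ⊩ φ.app [z] 0 := by
  have e' (w) : (φ.app [0] 1).inst w = φ.app [w] 0 := app_rename_eq (by rintro (_ | _) <;> rfl)
  exact e' z ▸ e.subst (φ.app [0] 1) (e' y ▸ h)

theorem into_app (ht : Γ ⊩ isFunInto t a φ 0) (h : Γ ⊩ pairMem x y t) : Γ ⊩ φ.app [y] 0 :=
  pairMemE h fun _ _ hp hpx => into_pair ht.m hp fun _ _ _ _ _ hpx' hy =>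
    app_congr hy (opair_snd hpx' hpx.m)

theorem into_dom (ht : Γ ⊩ isFunInto t a φ 0) (h : Γ ⊩ pairMem x y t) : Γ ⊩ mem x a :=
  pairMemE h fun _ _ hp hpx => into_pair ht.m hp fun _ _ _ _ hx hpx' _ =>
    (opair_fst hpx' hpx.m).mem_left hx

theorem into_fun (ht : Γ ⊩ isFunInto t a φ 0) (hc : ∀ x y, Γ ⊩ pairMem x y t ⟹ mem y b) :
    Γ ⊩ isFun t a b := by
  refine funI (fun p => impI' fun hp => into_pair ht.m hp fun x y _ _ _ h _ => exI x (exI y h))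
    (fun x y => impI' fun h => into_dom ht.m h) hc (fun x => impI' fun hx => ?_)
    (fun x y z => impI' fun hy => impI' fun hz => ?_)
  · exact exE₂ ((andE₂ ht).m.ballE hx) fun y _ hy _ => exI y hy
  · refine exE₂ (ballE (andE₂ ht).m (into_dom ht.m hz)) fun w θ _ hw => ?_
    have hw (v) : θ :: pairMem x z t :: pairMem x y t :: Γ ⊩ pairMem x v t ⟹ eq v w := allE v hw
    exact ((hw z).mp hz.m).trans ((hw y).mp hy.m).symm

theorem fun_pairs (h : Γ ⊩ isFun f a b) (p : ℕ) :
    Γ ⊩ mem p f ⟹ ex (ex (isOPair (p + 2) 1 0)) :=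
  impI' fun hp => fun_pair h.m hp fun x y _ _ _ _ hxy => exI x (exI y hxy)

/-! ### Ranges and composites -/

/-- Since `x, y ∈ {x, y} ∈ ⟨x, y⟩ ∈ s`, the double union of `s` works. It serves to bound
quantifiers over components of pairs in Separation. -/
theorem exists_field (s : ℕ) (k : ∀ V Δ, Step Γ Δ →
    (∀ x y, Δ ⊩ pairMem x y s ⟹ mem x V ⋏ mem y V) → (Δ ⊩ χ)) : Γ ⊩ χ := by
  refine exists_union s fun V₀ θ h₀ => exists_union V₀ fun V θ' h => k V _ .of fun x y => ?_
  refine impI' fun hxy => pairMemE hxy fun p _ hp hpx => opairE hpx fun _ v _ _ _ hv hpv => ?_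
  have hv₀ := mp (andE₂ (h₀ v)).m (bexI hp.m (upair_right hpv))
  exact andI (mp (andE₂ (h x)).m (bexI hv₀ (upair_left hv)))
    (mp (andE₂ (h y)).m (bexI hv₀ (upair_right hv)))

/-- `U` is the union of the values of the relation `s`. -/
def isImUnion (U s : ℕ) : Fml := all (mem 0 (U + 1) ⟺ ex (ex (pairMem 1 0 (s + 3) ⋏ mem 2 0)))

theorem imUnionI {U : ℕ} (hU : Γ ⊩ isImUnion U s) (h₁ : Γ ⊩ pairMem y z s) (h₂ : Γ ⊩ mem x z) :
    Γ ⊩ mem x U := by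
  have h : Γ ⊩ mem x U ⟺ ex (ex (pairMem 1 0 (s + 2) ⋏ mem (x + 2) 0)) := allE x hU
  exact h.iffMpr (exI y (exI z (andI h₁ h₂)))

theorem imUnionE {U : ℕ} (hU : Γ ⊩ isImUnion U s) (hx : Γ ⊩ mem x U)
    (k : ∀ y z Δ, Step Γ Δ → (Δ ⊩ pairMem y z s) → (Δ ⊩ mem x z) → (Δ ⊩ χ)) : Γ ⊩ χ := by
  have h : Γ ⊩ mem x U ⟺ ex (ex (pairMem 1 0 (s + 2) ⋏ mem (x + 2) 0)) := allE x hU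
  exact exE' (h.iffMp hx) fun y h' => exE₂ h' fun z _ h₁ h₂ => k y z _ .of h₁ h₂

theorem bounded_isUPair (p x y : ℕ) : Bounded (isUPair p x y) :=
  .and (.mem _ _) (.and (.mem _ _) (.ball _ (.or (.eq _ _) (.eq _ _))))

theorem bounded_isOPair (p x y : ℕ) : Bounded (isOPair p x y) :=
  .bex _ (.bex _ (.and (bounded_isUPair _ _ _) (.and (bounded_isUPair _ _ _)
    (bounded_isUPair _ _ _))))

theorem bounded_pairMem (x y r : ℕ) : Bounded (pairMem x y r) := .bex _ (bounded_isOPair _ _ _)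

theorem bounded_isSub (a b : ℕ) : Bounded (isSub a b) := .ball _ (.mem _ _)

theorem ex_imUnion (s : ℕ) : Γ ⊩ ex (isImUnion 0 (s + 1)) := by
  refine exists_field s fun V Δ _ hV => ?_
  refine exists_sep (bex (V + 1) (pairMem 0 1 (s + 2))) (.bex _ (bounded_pairMem _ _ _)) V
    fun D θ hD => exists_union D fun U θ' hU => exI U (allI' fun x => iffI (fun h => ?_) fun h => ?_)
  · refine bexE (mp (andE₁ (hU x)).m h) fun z _ hz hxz => ?_
    exact bexE (andE₂ (mp (andE₁ (hD z)).m hz)) fun y _ _ hyz => exI y (exI z (andI hyz hxz.m))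
  · refine exE' h fun y h' => exE₂ h' fun z θ'' (h₁ : _ ⊩ pairMem y z s) h₂ => ?_
    have h₃ := mp (hV y z).m h₁
    exact mp (andE₂ (hU x)).m (bexI (mp (andE₂ (hD z)).m (andI (andE₂ h₃) (bexI (andE₁ h₃) h₁))) h₂)

theorem exists_imUnion (s : ℕ) (k : ∀ U θ, (θ :: Γ ⊩ isImUnion U s) → (θ :: Γ ⊩ χ)) : Γ ⊩ χ :=
  exE' (ex_imUnion s) fun U hU => k U _ hU

theorem compI (hv : Γ ⊩ isComp v g u) (h₁ : Γ ⊩ pairMem x y u) (h₂ : Γ ⊩ pairMem y z g) :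
    Γ ⊩ pairMem x z v := by
  refine exists_opair x z fun p θ hp => pairMemI ?_ hp
  have h : θ :: Γ ⊩ mem p v ⟺ ex (ex (ex (isOPair (p + 3) 2 0 ⋏ pairMem 2 1 (u + 3) ⋏
    pairMem 1 0 (g + 3)))) := allE p hv.m
  exact h.iffMpr (exI x (exI y (exI z (andI hp (andI h₁.m h₂.m)))))

theorem exists_comp (hu : Γ ⊩ isFun u a b) (hg : Γ ⊩ isFun g b c)
    (k : ∀ v θ, (θ :: Γ ⊩ isComp v g u) → (θ :: Γ ⊩ χ)) : Γ ⊩ χ := by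
  refine exists_fun (ex (pairMem 1 0 (u + 3) ⋏ pairMem 0 2 (g + 3))) a c
    (fun x => impI' fun hx => fun_total hu.m hx fun y _ hy => fun_total hg.m (fun_cod hu.m hy)
      fun z _ hz => exI z (exI y (andI hy.m hz)))
    (fun x z => impI' fun _ => impI' fun h => exE₂ h fun y _ _ h' => fun_cod hg.m h')
    (fun x z z' => impI' fun _ => impI' fun h => impI' fun h' => exE₂ h.m fun y _ h₁ h₂ =>
      exE₂ h'.m fun y' _ h₁' h₂' => fun_unique hg.m h₂'
        (pairMem_congr_left h₂.m (fun_unique hu.m h₁.m h₁')))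
    fun v θ hv h₁ h₂ => k v θ (allI' fun p => iffI (fun hp => ?_) fun hp => ?_)
  · refine fun_pair hv.m hp fun x z _ _ _ _ hpx => ?_
    exact exE₂ (mp (h₁ x z).m (pairMemI hp.m hpx)) fun y _
      (h₃ : _ ⊩ pairMem x y u) (h₄ : _ ⊩ pairMem y z g) => exI x (exI y (exI z (andI hpx.m (andI h₃ h₄))))
  · refine exE' hp fun x h => exE' h fun y h => exE' h fun z
      (h : _ ⊩ isOPair p x z ⋏ pairMem x y u ⋏ pairMem y z g) => ?_
    exact pairMem_mem (mp (mp (h₂ x z).m (fun_dom hu.m (andE₁ (andE₂ h))))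
      (exI y (andE₂ h))) (andE₁ h)

/-! ### Bases -/

theorem baseI (h : ∀ S σ, Γ ⊩ isSurj σ S a ⟹
    ex (isFun 0 (a + 1) (S + 1) ⋏ ball (a + 1) (ball (S + 2) (pairMem 1 0 2 ⟹
      pairMem 0 1 (σ + 3))))) : Γ ⊩ isBase a :=
  allI' fun S => allI' fun σ => h S σ

theorem base_section (ha : Γ ⊩ isBase a) (hσ : Γ ⊩ isSurj σ S a)
    (k : ∀ s θ, (θ :: Γ ⊩ isFun s a S) → (∀ x y, θ :: Γ ⊩ pairMem x y s ⟹ pairMem y x σ) →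
      (θ :: Γ ⊩ χ)) : Γ ⊩ χ := by
  have h : Γ ⊩ isSurj σ S a ⟹ ex (isFun 0 (a + 1) (S + 1) ⋏ ball (a + 1) (ball (S + 2)
    (pairMem 1 0 2 ⟹ pairMem 0 1 (σ + 3)))) := allE σ (allE S ha)
  refine exE₂ (h.mp hσ) fun s θ h₁ h₂ => k s θ h₁ fun x y => impI' fun hxy => ?_
  have h₃ : pairMem x y s :: θ :: Γ ⊩ pairMem x y s ⟹ pairMem y x σ :=
    ballE (ballE h₂.m (fun_dom h₁.m hxy)) (fun_cod h₁.m hxy)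
  exact h₃.mp hxy

/-- Choice over a base. -/
theorem base_choice (φ : Fml) (ha : Γ ⊩ isBase a) (h : ∀ x, Γ ⊩ mem x a ⟹ ex (φ.app [x + 1, 0] 1))
    (hc : ∀ x y, Γ ⊩ φ.app [x, y] 0 ⟹ mem y b)
    (k : ∀ t Δ, Step Γ Δ → (Δ ⊩ isFun t a b) → (∀ x y, Δ ⊩ pairMem x y t ⟹ φ.app [x, y] 0) →
      (Δ ⊩ χ)) : Γ ⊩ χ := by
  -- The first projection `π` from the set `S` of related pairs onto the base `a` has a section `s`;
  -- the required `t` takes the second component of `s(x)`.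
  refine exists_graph φ a h fun S θ h₁ h₂ h₃ => ?_
  refine exists_fun (ex (isOPair 1 2 0)) S a
    (fun p => impI' fun hp => exE' ((h₁ p).m.mp hp) fun x h => exE' h fun y h =>
      exI x (exI y h)) (fun p x => impI' fun hp => impI' fun h => exE' h fun y h =>
        andE₁ (mp (h₂ x y).m (pairMemI hp.m h)))
    (fun p x x' => impI' fun hp => impI' fun h => impI' fun h' => exE' h.m fun y hy =>
      exE' h'.m fun y' hy' => opair_fst hy' hy.m) fun π θ₂ h₄ h₅ h₆ => ?_
  refine base_section (σ := π) (S := S) ha.m (surjI h₄ fun x => impI' fun hx =>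
    exE' ((h₃ x).m.mp hx) fun y hy => pairMemE hy fun p _ hp hpx =>
      exI p (mp (mp (h₆ p x).m hp) (exI y hpx))) fun s θ₃ h₇ h₈ => ?_
  refine exists_fun (ex (pairMem 1 0 (s + 3) ⋏ isOPair 0 1 2)) a b
    (fun x => impI' fun hx => fun_total h₇.m hx fun p _ hp =>
      exE' (mp (h₅ p x).m (mp (h₈ x p).m hp)) fun y hy => exI y (exI p (andI hp.m hy)))
    (fun x y => impI' fun _ => impI' fun h => exE₂ h fun p _ hp hpx =>
      mp (hc x y).m (andE₂ (mp (h₂ x y).m (pairMemI (fun_cod h₇.m hp) hpx))))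
    (fun x y z => impI' fun _ => impI' fun h => impI' fun h' => exE₂ h.m fun p _ hp hpx =>
      exE₂ h'.m fun q _ hq hqx => opair_snd hqx (opair_congr hpx.m (fun_unique h₇.m hp.m hq)))
    fun t θ₄ h₉ h₁₀ _ => k t _ .of h₉ fun x y => impI' fun hxy => ?_
  exact exE₂ (mp (h₁₀ x y).m hxy) fun p _ hp hpx =>
    andE₂ (mp (h₂ x y).m (pairMemI (fun_cod h₇.m hp) hpx))

/-- A function on `F` as a function on `Φ = {α} × F`. -/
theorem exists_transport {Φ : ℕ} (hΦ : ∀ p, Γ ⊩ mem p Φ ⟺ bex F (isOPair (p + 1) (α + 1) 0))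
    (ht : Γ ⊩ isFun t F V)
    (k : ∀ t' θ, (θ :: Γ ⊩ isFun t' Φ V) →
      (∀ p x, θ :: Γ ⊩ pairMem p x t' ⟹ ex (isOPair (p + 1) (α + 1) 0 ⋏
        pairMem 0 (x + 1) (t + 1))) →
      (∀ p z x, θ :: Γ ⊩ isOPair p α z ⟹ pairMem z x t ⟹ pairMem p x t') → (θ :: Γ ⊩ χ)) :
    Γ ⊩ χ := by
  refine exists_fun (ex (isOPair 1 (α + 3) 0 ⋏ pairMem 0 2 (t + 3))) Φ V
    (fun p => impI' fun hp => bexE (mp (andE₁ (hΦ p)).m hp) fun z _ hz hpz =>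
      fun_total ht.m hz fun x _ hx => exI x (exI z (andI hpz.m hx)))
    (fun p x => impI' fun _ => impI' fun h => exE₂ h fun z _ _ hz => fun_cod ht.m hz)
    (fun p x x' => impI' fun _ => impI' fun h => impI' fun h' => exE₂ h.m fun z _ hp hz =>
      exE₂ h'.m fun z' _ hp' hz' => fun_unique ht.m hz'
        (pairMem_congr_left hz.m (opair_snd hp.m hp')))
    fun t' θ h₁ h₂ h₃ => k t' θ h₁ h₂ fun p z x => impI' fun hp => impI' fun hz => ?_
  exact mp (mp (h₃ p x).m (mp (andE₂ (hΦ p)).m (bexI (fun_dom ht.m hz) hp.m)))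
    (exI z (andI hp.m hz))

/-- Given a surjection onto `Φ = {α} × F`, choice over `F` picks a preimage of each `⟨α, z⟩`, and
the choice function is transported back to `Φ`. -/
theorem base_copy {Φ : ℕ} (hF : Γ ⊩ isBase F)
    (hΦ : ∀ p, Γ ⊩ mem p Φ ⟺ bex F (isOPair (p + 1) (α + 1) 0)) : Γ ⊩ isBase Φ := by
  refine baseI fun S σ => impI' fun hσ => ?_
  refine base_choice (b := S) (ex (isOPair 0 (α + 3) 1 ⋏ pairMem 2 0 (σ + 3))) hF.m
    (fun z => impI' fun hz => exists_opair α z fun p _ hp =>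
      surjE hσ.m (mp (andE₂ (hΦ p)).m (bexI hz.m hp)) fun x _ hx => exI x (exI p (andI hp.m hx)))
    (fun z x => impI' fun h => exE₂ h fun p _ _ hp => fun_dom (surj_fun hσ.m) hp)
    fun t Δ _ ht h₁ => exists_transport (fun p => (hΦ p).m) ht fun s θ h₂ h₃ _ => ?_
  refine exI s (andI h₂ (ballI fun p _ => ballI fun x _ => impI' fun hpx => ?_))
  refine exE₂ (mp (h₃ p x).m hpx) fun z _ hp hz => exE₂ (mp (h₁ z x).m hz) fun q _ hq hx => ?_
  exact pairMem_congr_right hx (opair_unique hq hp.m)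

theorem ex_presentation (a : ℕ) : Γ ⊩ ex (isBase 0 ⋏ ex (isSurj 0 1 (a + 2))) :=
  allE a (Prov.ax (φ := presentationAxiom) (Or.inr (Or.inl rfl)))

/-! ### Base maps -/

theorem fibreI {Φ : ℕ} (h₁ : ∀ p, Γ ⊩ mem p Φ ⟹ mem p B ⋏ pairMem p α f)
    (h₂ : ∀ p, Γ ⊩ mem p B ⟹ pairMem p α f ⟹ mem p Φ) : Γ ⊩ isFibre Φ f B α :=
  andI (allI' h₁) (allI' h₂)

theorem fibre_mem {Φ : ℕ} (h : Γ ⊩ isFibre Φ f B α) (hp : Γ ⊩ mem p Φ) : Γ ⊩ pairMem p α f :=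
  andE₂ ((andE₁ h).ballE hp)

theorem mem_fibre {Φ : ℕ} (h : Γ ⊩ isFibre Φ f B α) (hp : Γ ⊩ mem p B) (hf : Γ ⊩ pairMem p α f) :
    Γ ⊩ mem p Φ := by
  have h' : Γ ⊩ pairMem p α f ⟹ mem p Φ := (andE₂ h).ballE hp
  exact h'.mp hf

theorem fibre_sub {Φ Ψ : ℕ} (h : Γ ⊩ isFibre Φ f B α) (h' : Γ ⊩ isFibre Ψ f B α) :
    Γ ⊩ isSub Φ Ψ :=
  subI fun _ hp => mem_fibre h'.m (andE₁ ((andE₁ h).m.ballE hp)) (fibre_mem h.m hp)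

theorem fibre_unique {Φ Ψ : ℕ} (h : Γ ⊩ isFibre Φ f B α) (h' : Γ ⊩ isFibre Ψ f B α) :
    Γ ⊩ eq Φ Ψ :=
  Prov.ext (fibre_sub h h') (fibre_sub h' h)

theorem baseMap_fibre (hf : Γ ⊩ isBaseMap f B A) (hα : Γ ⊩ mem α A) (hF : Γ ⊩ isFibre F f B α) :
    Γ ⊩ isBase F :=
  mp (φ := isFibre F f B α) (allE F ((andE₂ (andE₂ hf)).ballE hα)) hF

/-- A family of bases indexed by a base is the family of fibres of a base map, up to isomorphism. -/
theorem exists_baseMap (hA : Γ ⊩ isBase A) (he : Γ ⊩ isFun e A D)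
    (hD : ∀ F, Γ ⊩ mem F D ⟹ isBase F)
    (k : ∀ B f Δ, Step Γ Δ → (Δ ⊩ isBaseMap f B A) →
      (∀ α F, Δ ⊩ pairMem α F e ⟹ ex (isFibre 0 (f + 1) (B + 1) (α + 1) ⋏
        all (mem 0 1 ⟺ bex (F + 2) (isOPair 1 (α + 3) 0)))) → (Δ ⊩ χ)) : Γ ⊩ χ := by
  refine exists_union D fun U θ hU => exists_prod A U fun P Δ _ hP => ?_
  -- `B` is the disjoint union of the sets `e(α)`, and `f` will be its first projection, with fibres
  -- `{α} × e(α)`.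
  refine exists_sep (bex (A + 1) (bex (D + 2) (bex 0 (pairMem 2 1 (e + 4) ⋏ isOPair 3 2 0))))
    (.bex _ (.bex _ (.bex _ (.and (bounded_pairMem _ _ _) (bounded_isOPair _ _ _))))) P
    fun B θ₁ hB => ?_
  have hB₁ {Γ'} (_ : Step (θ₁ :: Δ) Γ') {p} {χ} (hp : Γ' ⊩ mem p B) (k : ∀ α F z Γ'', Step Γ' Γ'' →
      (Γ'' ⊩ pairMem α F e) → (Γ'' ⊩ mem z F) → (Γ'' ⊩ isOPair p α z) → (Γ'' ⊩ χ)) : Γ' ⊩ χ :=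
    bexE (andE₂ (mp (andE₁ (hB p)).m hp)) fun α _ _ h => h.bexE fun F _ _ h => h.bexE
      fun z _ hz h => k α F z _ .of (andE₁ h) hz (andE₂ h)
  have hB₂ {Γ'} (_ : Step (θ₁ :: Δ) Γ') {p α F z} (h₁ : Γ' ⊩ pairMem α F e) (h₂ : Γ' ⊩ mem z F)
      (h₃ : Γ' ⊩ isOPair p α z) : Γ' ⊩ mem p B := by
    have hα := fun_dom he.m h₁
    have hF := fun_cod he.m h₁
    exact mp (andE₂ (hB p)).m (andI (mp (mp (mp (hP p α z).m hα) (mp (andE₂ (hU z)).m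
      (bexI hF h₂))) h₃) (bexI hα (bexI hF (bexI h₂ (andI h₁ h₃)))))
  refine exists_fun (ex (isOPair 1 2 0)) B A
    (fun p => impI' fun hp => hB₁ .of hp fun α F z _ _ _ _ h => exI α (exI z h))
    (fun p x => impI' fun hp => impI' fun h => exE' h fun y (hy : _ ⊩ isOPair p x y) =>
      hB₁ .of hp.m fun α F z _ _ h₁ _ h => (opair_fst h hy.m).mem_left (fun_dom he.m h₁))
    (fun p x x' => impI' fun hp => impI' fun h => impI' fun h' => exE' h.m fun y hy =>
      exE' h'.m fun y' hy' => opair_fst hy' hy.m) fun f θ₂ hf hf₁ hf₂ => ?_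
  have key {Γ'} (_ : Step (θ₂ :: θ₁ :: Δ) Γ') {α F Φ} (hα : Γ' ⊩ pairMem α F e)
      (hΦ : Γ' ⊩ isFibre Φ f B α) (p) : Γ' ⊩ mem p Φ ⟺ bex F (isOPair (p + 1) (α + 1) 0) := by
    refine iffI (fun hp => ?_) (fun h => h.bexE fun z θ₃ hz (hpz : _ ⊩ isOPair p α z) => ?_)
    · have hp' := fibre_mem hΦ.m hp
      refine exE' (mp (hf₁ p α).m hp') fun y (hy : _ ⊩ isOPair p α y) => ?_
      refine hB₁ .of (fun_dom hf.m hp'.m) fun α' F' z _ _ h₁ h₂ h₃ => ?_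
      have h₄ := opair_fst h₃ hy.m
      exact bexI ((fun_unique he.m (pairMem_congr_left h₁ h₄) hα.m).mem_right h₂)
        (opair_congr_left h₃ h₄)
    · have hp := hB₂ .of hα.m hz hpz
      exact mem_fibre hΦ.m hp (mp (mp (hf₂ p α).m hp) (exI z hpz))
  refine k B f _ .of (andI hf (andI hA.m (ballI fun α hα => allI' fun Φ => impI' fun hΦ => ?_)))
    fun α F => impI' fun hα => ?_
  · exact fun_total he.m hα.m fun F θ₃ hF =>
      base_copy (mp (hD F).m (fun_cod he.m hF)) fun p => key .of hF hΦ.m p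
  · refine exists_sep (pairMem 0 (α + 1) (f + 1)) (bounded_pairMem _ _ _) B fun Φ θ₃ h => ?_
    have hΦ : _ ⊩ isFibre Φ f B α :=
      fibreI (fun p => andE₁ (h p)) fun p => impI' fun h₁ => impI' fun h₂ =>
        mp (andE₂ (h p)).m (andI h₁.m h₂)
    exact exI Φ (andI hΦ (allI' fun p => key .of hα.m hΦ p))

/-- There is a base map such that the premise of each pair in `R` is covered by a fibre. -/
theorem exists_cover (R : ℕ) (k : ∀ A B f Δ, Step Γ Δ → (Δ ⊩ isBaseMap f B A) →
    (∀ a b, Δ ⊩ pairMem a b R ⟹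
      bex A (ex (isFibre 0 (f + 2) (B + 2) 1 ⋏ ex (isSurj 0 1 (a + 3))))) → (Δ ⊩ χ)) : Γ ⊩ χ := by
  refine exists_field R fun V Δ _ hV => ?_
  refine exists_collection (isBase 1 ⋏ ex (isSurj 0 2 1)) V
    (fun a => impI' fun _ => ex_presentation a) fun D θ hD₁ hD₂ => ?_
  -- The presentation axiom is used a second time because the set indexing the fibres must itself be
  -- a base.
  refine exE₂ (ex_presentation D) fun A θ₁ hA he => exE' he fun e
    (he : _ ⊩ isSurj e A D) => ?_
  refine exists_baseMap hA.m (surj_fun he) (fun F => impI' fun hF => bexE (mp (hD₂ F).m hF)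
    fun a _ _ h => andE₁ h) fun B f Δ' _ hf h => k A B f Δ' .of hf fun a b => impI' fun hab => ?_
  refine bexE (mp (hD₁ a).m (andE₁ (mp (hV a b).m hab))) fun F _ hF h₁ => ?_
  refine exE' (andE₂ h₁) fun q (hq : _ ⊩ isSurj q F a) => surjE he.m hF.m fun α _ hα => ?_
  refine exE₂ (mp (h α F).m hα) fun Φ _ (hΦ : _ ⊩ isFibre Φ f B α) hΦ' => ?_
  refine exists_transport (Φ := Φ) (F := F) (α := α) (fun p => allE p hΦ') (surj_fun hq.m)
    fun q' _ h₂ _ h₃ => ?_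
  refine bexI (fun_dom (surj_fun he.m) hα.m) (exI Φ (andI hΦ.m (exI q' (surjI h₂ fun x =>
    impI' fun hx => surjE hq.m hx fun z _ hz => exists_opair α z fun p _ hp => ?_))))
  exact exI p (mp (mp (h₃ p z x).m hp) hz.m)

/-! ### Relativised dependent choice -/

theorem Prov.of_eq (e : φ = ψ) (h : Γ ⊩ ψ) : Γ ⊩ φ := e ▸ h

theorem prov_rdcw (h : IsAxiomRDCW φ) : Γ ⊩ φ := Prov.ax (Or.inr (Or.inr h))

theorem exists_wtype (hf : Γ ⊩ isBaseMap f B A)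
    (k : ∀ W s Δ, Step Γ Δ → (Δ ⊩ isWType W s f B A) → (Δ ⊩ χ)) : Γ ⊩ χ := by
  have h : Γ ⊩ isBaseMap f B A ⟹ ex (ex (isWType 1 0 (f + 2) (B + 2) (A + 2))) :=
    allE f (allE B (allE A (prov_rdcw .exist)))
  exact exE' (h.mp hf) fun W h => exE' h fun s h => k W s _ .of h

theorem relativisedWChoice_inst (φ ρ : Fml) (A B f W s : ℕ) :
    Γ ⊩ isBaseMap f B A ⟹ isWType W s f B A ⟹
      ball A (all (all (isFibre 1 (f + 3) (B + 3) 2 ⟹ isFunInto 0 1 φ 3 ⟹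
        ex (φ.app [0] 4 ⋏ ρ.app [3, 1, 0] 4)))) ⟹
      ex (isFunInto 0 (W + 1) φ 1 ⋏ all (all (all (all (all (algVal (s + 6) 4 3 2 ⟹
        isComp 1 5 3 ⟹ pairMem 2 0 5 ⟹ ρ.app [4, 1, 0] 6)))))) := by
  have h := allE (Γ := Γ) s (allE W (allE f (allE B (allE A
    (prov_rdcw (.choice φ ρ))))))
  unfold Fml.inst at h
  simp only [isFunInto, ball, bex, Fml.rename, rename_rename] at h
  rw [app_rename_eq (l := [0]) (d := 8 + 3) (l' := [0]) (d' := 6),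
    app_rename_eq (l := [0]) (d := 9) (l' := [0]) (d' := 4),
    app_rename_eq (l := [3, 1, 0]) (l' := [3, 1, 0]) (d' := 4),
    app_rename_eq (l := [4, 1, 0]) (l' := [4, 1, 0]) (d' := 6)] at h
  · exact h
  all_goals rintro (_ | _ | _ | _) <;> rfl

/-- In `φ` the variable `0` is the element of the class; in `ρ` the variables `0`, `1`, `2` are the
index, the family on the fibre and the new value. Outer variables are raised by `1` and `3`
respectively. -/
theorem exists_wchoice (φ ρ : Fml) (hf : Γ ⊩ isBaseMap f B A) (hW : Γ ⊩ isWType W s f B A)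
    (h : ∀ a F t, Γ ⊩ mem a A ⟹ isFibre F f B a ⟹ isFunInto t F φ 0 ⟹
      ex (φ.app [0] 1 ⋏ ρ.app [a + 1, t + 1, 0] 1))
    (k : ∀ h θ, (θ :: Γ ⊩ isFunInto h W φ 0) → (∀ a u w v y, θ :: Γ ⊩ algVal s a u w ⟹
      isComp v h u ⟹ pairMem w y h ⟹ ρ.app [a, v, y] 0) → (θ :: Γ ⊩ χ)) : Γ ⊩ χ := by
  refine exE₂ ((((relativisedWChoice_inst φ ρ A B f W s).mp hf).mp hW).mp (ballI fun a ha =>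
    allI' fun F => allI' fun t => Prov.of_eq ?_ ((h a F t).m.mp ha))) fun h θ h₁ h₂ => k h θ ?_ ?_
  · unfold Fml.inst
    simp only [isFunInto, ball, bex, Fml.rename, rename_rename]
    rw [app_rename_eq (l := [0]) (d := 3 + 3) (l' := [0]) (d' := 3),
      app_rename_eq (l := [0]) (d := 4) (l' := [0]) (d' := 1),
      app_rename_eq (l := [3, 1, 0]) (l' := [a + 1, t + 1, 0]) (d' := 1)]
    · rfl
    all_goals rintro (_ | _ | _ | _) <;> rfl
  · unfold Fml.inst at h₁
    simp only [isFunInto, ball, bex, Fml.rename] at h₁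
    rw [app_rename_eq (l := [0]) (d := 1 + 3) (l' := [0]) (d' := 3)] at h₁
    · exact h₁
    rintro (_ | _) <;> rfl
  · intro a u w v y
    have h₃ := allE y (allE v (allE w (allE u (allE a h₂))))
    unfold Fml.inst at h₃
    simp only [Fml.rename, rename_rename] at h₃
    rw [app_rename_eq (l := [4, 1, 0]) (l' := [a, v, y]) (d' := 0)] at h₃
    · exact h₃
    rintro (_ | _ | _ | _) <;> rfl

/-- The operation of a W-type applies to all functions from a fibre to the W-type. -/
theorem wtype_sup (hW : Γ ⊩ isWType W s f B A) (ha : Γ ⊩ mem a A) (hF : Γ ⊩ isFibre F f B a)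
    (ht : Γ ⊩ isFun t F W) (k : ∀ w Δ, Step Γ Δ → (Δ ⊩ mem w W) → (Δ ⊩ algVal s a t w) → (Δ ⊩ χ)) :
    Γ ⊩ χ := by
  refine exE₂ (andE₁ hW) fun P θ hP (hs : _ ⊩ isFun s P W) => ?_
  refine exists_opair a t fun p θ' hp => ?_
  have h : θ' :: θ :: Γ ⊩ mem p P ⟺ bex A (ex (ex (isFibre 1 (f + 3) (B + 3) 2 ⋏
    isFun 0 1 (W + 3) ⋏ isOPair (p + 3) 2 0))) := allE p hP.m
  refine fun_total hs.m (h.iffMpr (bexI ha.m (exI F (exI t (andI hF.m (andI ht.m hp))))))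
    fun w _ hw => k w _ .of (fun_cod hs.m hw) (exI p (andI hp.m hw))

/-! ### Closed sets -/

theorem fun_restrict_cod (h : Γ ⊩ isFun f a b) (hc : ∀ x y, Γ ⊩ pairMem x y f ⟹ mem y c) :
    Γ ⊩ isFun f a c :=
  funI (fun_pairs h) (fun _ _ => impI' fun h' => fun_dom h.m h') hc
    (fun _ => impI' fun hx => fun_total h.m hx fun y _ hy => exI y hy)
    (fun _ _ _ => impI' fun hy => impI' fun hz => fun_unique h.m hz hy.m)

theorem fun_congr_dom (h : Γ ⊩ isFun f a b) (e : Γ ⊩ eq a c) : Γ ⊩ isFun f c b :=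
  e.subst (isFun (f + 1) 0 (b + 1)) h

theorem fun_congr_cod (h : Γ ⊩ isFun f a b) (e : Γ ⊩ eq b c) : Γ ⊩ isFun f a c :=
  e.subst (isFun (f + 1) (a + 1) 0) h

theorem imUnion_subI {U : ℕ} (h : Γ ⊩ isImUnion U s)
    (h' : ∀ y z, Γ ⊩ pairMem y z s ⟹ isSub z a) : Γ ⊩ isSub U a :=
  subI fun _ hx => imUnionE h.m hx fun y z _ _ h₁ h₂ => subE (mp (h' y z).m h₁) h₂

theorem imUnion_sub {U U' : ℕ} (h : Γ ⊩ isImUnion U s) (h' : Γ ⊩ isImUnion U' s) :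
    Γ ⊩ isSub U U' :=
  subI fun _ hx => imUnionE h.m hx fun _ _ _ _ h₁ h₂ => imUnionI h'.m h₁ h₂

theorem imUnion_unique {U U' : ℕ} (h : Γ ⊩ isImUnion U s) (h' : Γ ⊩ isImUnion U' s) :
    Γ ⊩ eq U U' :=
  Prov.ext (imUnion_sub h h') (imUnion_sub h' h)

/-- The conclusion of each rule in `R` whose premise is contained in `U` meets `Z`. -/
def isStep (U Z R : ℕ) : Fml :=
  all (all (pairMem 1 0 (R + 2) ⟹ isSub 1 (U + 2) ⟹ bex 0 (mem 0 (Z + 3))))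

/-- Each `R`-closed subset of `X` that contains `U` has a subset in `C` which meets the conclusion
of each rule with premise contained in `U`. -/
def isSupply (C U R X : ℕ) : Fml :=
  all (isClosed 0 (R + 1) (X + 1) ⟹ isSub (U + 1) 0 ⟹
    bex (C + 1) (isSub 0 1 ⋏ isStep (U + 2) 0 (R + 2)))

theorem stepI (h : ∀ a b, Γ ⊩ pairMem a b R ⟹ isSub a U ⟹ bex b (mem 0 (Z + 1))) :
    Γ ⊩ isStep U Z R :=
  allI' fun a => allI' fun b => h a b

theorem stepE (h : Γ ⊩ isStep U Z R) (hab : Γ ⊩ pairMem a b R) (ha : Γ ⊩ isSub a U)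
    (k : ∀ y θ, (θ :: Γ ⊩ mem y b) → (θ :: Γ ⊩ mem y Z) → (θ :: Γ ⊩ χ)) : Γ ⊩ χ := by
  have h' : Γ ⊩ pairMem a b R ⟹ isSub a U ⟹ bex b (mem 0 (Z + 1)) := allE b (allE a h)
  exact ((h'.mp hab).mp ha).bexE k

theorem closed_sub (h : Γ ⊩ isClosed Y R X) : Γ ⊩ isSub Y X := andE₁ h

theorem closed_step (h : Γ ⊩ isClosed Y R X) : Γ ⊩ isStep Y Y R := andE₂ h

theorem closedI (h : Γ ⊩ isSub Y X) (h' : Γ ⊩ isStep Y Y R) : Γ ⊩ isClosed Y R X := andI h h'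

theorem supplyI (h : ∀ Y, Γ ⊩ isClosed Y R X ⟹ isSub U Y ⟹
    bex C (isSub 0 (Y + 1) ⋏ isStep (U + 1) 0 (R + 1))) : Γ ⊩ isSupply C U R X :=
  allI' h

theorem supplyE (h : Γ ⊩ isSupply C U R X) (hY : Γ ⊩ isClosed Y R X) (hU : Γ ⊩ isSub U Y)
    (k : ∀ Z θ, (θ :: Γ ⊩ mem Z C) → (θ :: Γ ⊩ isSub Z Y) → (θ :: Γ ⊩ isStep U Z R) →
      (θ :: Γ ⊩ χ)) : Γ ⊩ χ := by
  have h' : Γ ⊩ isClosed Y R X ⟹ isSub U Y ⟹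
    bex C (isSub 0 (Y + 1) ⋏ isStep (U + 1) 0 (R + 1)) := allE Y h
  exact ((h'.mp hY).mp hU).bexE fun Z θ h₁ h₂ => k Z θ h₁ (andE₁ h₂) (andE₂ h₂)

theorem supply_mono (h : Γ ⊩ isSupply C U R X) (hC : Γ ⊩ isSub C D) : Γ ⊩ isSupply D U R X :=
  supplyI fun _ => impI' fun hY => impI' fun hU => supplyE h.m hY.m hU fun _ _ h₁ h₂ h₃ =>
    bexI (hC.m.subE h₁) (andI h₂ h₃)

/-- Apply Subset Collection to the rules with premise in `U` and to `X`, with parameter `Y`: a rule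
is related to the elements of its conclusion that lie in `Y`. One set `C` then serves all closed `Y
⊇ U`. -/
theorem ex_supply (U R X : ℕ) : Γ ⊩ ex (isSupply 0 (U + 1) (R + 1) (X + 1)) := by
  refine exists_field R fun V Δ _ hV => ?_
  refine exists_sep (bex (V + 1) (bex (V + 2) (isOPair 2 1 0 ⋏ isSub 1 (U + 3))))
    (.bex _ (.bex _ (.and (bounded_isOPair _ _ _) (bounded_isSub _ _)))) R fun P θ hP => ?_
  refine exists_subset_collection (mem 1 2 ⋏ ex (ex (isOPair 2 1 0 ⋏ mem 3 0))) P X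
    fun C θ' hC => exI C (supplyI fun Y => impI' fun hY => impI' fun hU => ?_)
  refine bexE ((hC Y).m.mp (ballI fun r hr => ?_)) fun Z _ hZ h => ?_
  · have hr := mp (andE₁ (hP r)).m hr
    refine bexE (andE₂ hr) fun a _ ha h => h.bexE fun b _ hb
      (h : _ ⊩ isOPair r a b ⋏ isSub a U) => ?_
    refine stepE (closed_step hY.m) (pairMemI (andE₁ hr).m (andE₁ h))
      (sub_trans (andE₂ h) hU.m) fun y _ hy hyY => ?_
    exact bexI (subE (closed_sub hY.m) hyY) (andI hyY (exI a (exI b (andI (andE₁ h).m hy))))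
  · refine bexI hZ (andI (subI fun y hy => ?_) (stepI fun a b => impI' fun hab => impI' fun ha => ?_))
    · exact bexE ((andE₂ h).m.ballE hy) fun r _ _ h' => andE₁ h'
    · have hV' := mp (hV a b).m hab
      refine pairMemE hab.m fun r _ hr hrab => ?_
      have hrP := mp (andE₂ (hP r)).m (andI hr (bexI (andE₁ hV').m (bexI (andE₂ hV').m
        (andI hrab ha.m))))
      refine bexE (ballE (andE₁ h).m hrP) fun y _ hy h' => ?_
      refine exE' (andE₂ h') fun a' h₁ => exE' h₁ fun b'
        (h₂ : _ ⊩ isOPair r a' b' ⋏ mem y b') => ?_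
      exact bexI ((opair_snd (andE₁ h₂) hrab.m).mem_right (andE₂ h₂)) hy.m

/-- A set of subsets which suffices for all families indexed by a fibre of a base map. -/
theorem exists_supply (hf : Γ ⊩ isBaseMap f B A) (hW : Γ ⊩ isWType W s f B A) (R X : ℕ)
    (k : ∀ K Δ, Step Γ Δ → (∀ α F r U, Δ ⊩ mem α A ⟹ isFibre F f B α ⟹ isFun r F K ⟹
      isImUnion U r ⟹ isSupply K U R X) → (Δ ⊩ χ)) : Γ ⊩ χ := by
  -- The class is the whole universe. The relation says that the new set is a supply for `⋃ r`, for
  -- every `r` from the fibre to the union of the earlier sets.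
  refine exists_wchoice (eq 0 0) (all (all (all (all (isFibre 3 (f + 7) (B + 7) 4 ⟹
    isImUnion 2 5 ⟹ isFun 1 3 2 ⟹ isImUnion 0 1 ⟹ isSupply 6 0 (R + 7) (X + 7)))))) hf hW
    (fun a F t => impI' fun _ => impI' fun hF => impI' fun _ => ?_) fun g θ hg hg' => ?_
  -- Totality: exponentiation bounds the functions `r`, a supply is collected for each, and their
  -- union works because enlarging a supply preserves it.
  · refine exists_imUnion t fun K θ hK => exists_exp F K fun E Δ _ hE => ?_
    refine exists_collection (all (isImUnion 0 1 ⟹ isSupply 2 0 (R + 3) (X + 3))) E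
      (fun r => impI' fun _ => exists_imUnion r fun U _ hU => exE' (ex_supply U R X)
        fun C (hC : _ ⊩ isSupply C U R X) => exI C (allI' fun U' => impI' fun hU' =>
          (imUnion_unique hU.m hU').subst (isSupply (C + 1) 0 (R + 1) (X + 1)) hC.m))
      fun S θ₁ hS _ => exists_union S fun C θ₂ hC => exI C (andI (eqI C) ?_)
    refine allI' fun F' => allI' fun K' => allI' fun r => allI' fun U => ?_
    have key : θ₂ :: θ₁ :: Δ ⊩ isFibre F' f B a ⟹ isImUnion K' t ⟹ isFun r F' K' ⟹
        isImUnion U r ⟹ isSupply C U R X := by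
      refine impI' fun hF' => impI' fun hK' => impI' fun hr => impI' fun hU => ?_
      have hr' := fun_congr_cod (fun_congr_dom hr (fibre_unique hF'.m hF.m))
        (imUnion_unique hK'.m hK.m)
      refine bexE (mp (hS r).m (mp (hE r).m hr'.m)) fun c _ hc h => ?_
      exact supply_mono (mp (φ := isImUnion U r) (allE U h) hU.m) (subI fun y hy => mp (andE₂ (hC y)).m (bexI hc.m hy))
    exact key
  · refine exists_field g fun V Δ _ hV => exists_imUnion g fun K θ₁ hK => k K _ .of fun α F r U =>
      impI' fun hα => impI' fun hF => impI' fun hr => impI' fun hU => ?_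
    have hg₁ := into_fun (b := V) (hg.m : Δ ⊩ _) fun x y => impI' fun h =>
      andE₂ (mp (hV x y).m h)
    -- The fibre is a base, so there is `t : F → W` with `r(x) ∈ g(t(x))`. Hence `r` maps into `⋃
    -- g(t(x))`, and `g(sup_α t) ⊆ K` is a supply for `⋃ r`.
    refine base_choice (b := W) (ex (ex (pairMem 2 0 (r + 4) ⋏ pairMem 3 1 (g + 4) ⋏ mem 0 1)))
      (baseMap_fibre hf.m hα.m hF.m) (fun x => impI' fun hx => fun_total hr.m hx fun z _ hz =>
        imUnionE hK.m (fun_cod hr.m hz) fun w c _ _ h₁ h₂ =>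
          exI w (exI c (exI z (andI hz.m (andI h₁ h₂)))))
      (fun x w => impI' fun h => exE' h fun c h => exE' h fun z
        (h : _ ⊩ pairMem x z r ⋏ pairMem w c g ⋏ mem z c) => fun_dom hg₁.m (andE₁ (andE₂ h)))
      fun t Δ₁ _ ht ht' => ?_
    refine exists_comp ht hg₁.m fun v θ₂ hv => exists_imUnion v fun K' θ₃ hK' => ?_
    refine wtype_sup hW.m hα.m hF.m ht.m fun w Δ₂ _ hw hw' => fun_total hg₁.m hw fun c θ₄ hc => ?_
    have h₁ := mp (mp (mp (hg' α t w v c).m hw'.m) hv.m) hc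
    have h₂ : θ₄ :: Δ₂ ⊩ isFibre F f B α ⟹ isImUnion K' v ⟹ isFun r F K' ⟹
        isImUnion U r ⟹ isSupply c U R X := allE U (allE r (allE K' (allE F h₁)))
    refine supply_mono (mp (mp (mp (mp h₂ hF.m) hK'.m) (fun_restrict_cod hr.m fun x z =>
      impI' fun hz => ?_)) hU.m) (subI fun y hy => imUnionI hK.m hc.m hy)
    refine fun_total ht.m (fun_dom hr.m hz) fun w' _ hw₁ => exE' (mp (ht' x w').m hw₁)
      fun c' h => exE' h fun z' (h : _ ⊩ pairMem x z' r ⋏ pairMem w' c' g ⋏ mem z' c') => ?_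
    exact imUnionI hK'.m (compI hv.m hw₁.m (andE₁ (andE₂ h)))
      ((fun_unique hr.m (andE₁ h) hz.m).mem_left (andE₂ (andE₂ h)))

/-! ### Set-generation -/

/-- A family of subsets along a W-type whose union is closed. -/
theorem wtype_union_closed (hf : Γ ⊩ isBaseMap f B A) (hW : Γ ⊩ isWType W s f B A)
    (hR : ∀ a b, Γ ⊩ pairMem a b R ⟹
      bex A (ex (isFibre 0 (f + 2) (B + 2) 1 ⋏ ex (isSurj 0 1 (a + 3)))))
    (hh : Γ ⊩ isFun h W K) (hZ : Γ ⊩ isImUnion Z h)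
    (hs : ∀ a u w v y U, Γ ⊩ algVal s a u w ⟹ isComp v h u ⟹ pairMem w y h ⟹
      isImUnion U v ⟹ isStep U y R) : Γ ⊩ isStep Z Z R := by
  refine stepI fun a b => impI' fun hab => impI' fun ha => ?_
  refine bexE (mp (hR a b).m hab.m) fun α _ hα h₁ => exE₂ h₁ fun Φ _
    (hΦ : _ ⊩ isFibre Φ f B α) h₂ => exE' h₂ fun q (hq : _ ⊩ isSurj q Φ a) => ?_
  refine base_choice (b := W) (ex (ex (pairMem 2 1 (q + 4) ⋏ pairMem 3 0 (h + 4) ⋏ mem 1 0)))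
    (baseMap_fibre hf.m hα.m hΦ.m)
    (fun p => impI' fun hp => fun_total (surj_fun hq.m) hp fun x _ hx =>
      imUnionE hZ.m (subE ha.m (fun_cod (surj_fun hq.m) hx)) fun w z _ _ h₁ h₂ =>
        exI w (exI x (exI z (andI hx.m (andI h₁ h₂)))))
    (fun p w => impI' fun h₁ => exE' h₁ fun x h₂ => exE' h₂ fun z
      (h₃ : _ ⊩ pairMem p x q ⋏ pairMem w z h ⋏ mem x z) => fun_dom hh.m (andE₁ (andE₂ h₃)))
    fun t Δ _ ht ht' => ?_
  refine exists_comp ht hh.m fun v θ hv => exists_imUnion v fun U θ₁ hU => ?_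
  refine wtype_sup hW.m hα.m hΦ.m ht.m fun w Δ' _ hw hw' => fun_total hh.m hw fun y θ₂ hy => ?_
  -- Here `y = h(sup_α t)`, and `a ⊆ U = ⋃ h(t(p))` because `q` covers `a` and `q(p) ∈ h(t(p))`.
  refine stepE (mp (mp (mp (mp (hs α t w v y U).m hw'.m) hv.m) hy) hU.m) hab.m
    (subI fun x hx => ?_) fun z _ hz hzy => bexI hz (imUnionI hZ.m hy.m hzy)
  refine surjE hq.m hx fun p _ hp => fun_total ht.m (fun_dom (surj_fun hq.m) hp) fun w' _ hw₁ => ?_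
  refine exE' (mp (ht' p w').m hw₁) fun x' h₁ => exE' h₁ fun z
    (h₂ : _ ⊩ pairMem p x' q ⋏ pairMem w' z h ⋏ mem x' z) => ?_
  exact imUnionI hU.m (compI hv.m hw₁.m (andE₁ (andE₂ h₂)))
    ((fun_unique (surj_fun hq.m) (andE₁ h₂) hp.m).mem_left (andE₂ (andE₂ h₂)))

/-- There is a set of closed sets such that each closed set has a subset in it. -/
theorem ex_coinitial (R X : ℕ) :
    Γ ⊩ ex (ball 0 (isClosed 0 (R + 2) (X + 2)) ⋏
      all (isClosed 0 (R + 2) (X + 2) ⟹ bex 1 (isSub 0 1))) := by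
  refine exists_cover R fun A B f Δ _ hf hR => exists_wtype hf fun W s Δ₁ _ hW =>
    exists_supply hf.m hW R X fun K Δ₂ _ hK => exists_exp W K fun E Δ₃ _ hE => ?_
  refine exists_collection (isImUnion 1 0) E (fun h => impI' fun _ => ex_imUnion h)
    fun S θ hS _ => exists_field R fun V Δ₄ _ hV => ?_
  -- Being closed is made a bounded formula by letting premises and conclusions range over the field
  -- `V` of `R`.
  refine exists_sep (isSub 0 (X + 1) ⋏ ball (V + 1) (ball (V + 2) (pairMem 1 0 (R + 3) ⟹
      isSub 1 2 ⟹ bex 0 (mem 0 3))))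
    (.and (bounded_isSub _ _) (.ball _ (.ball _ (.imp (bounded_pairMem _ _ _)
      (.imp (bounded_isSub _ _) (.bex _ (.mem _ _))))))) S fun G θ₁ hG => ?_
  refine exI G (andI (ballI fun Z hZ => ?_) (allI' fun Y => impI' fun hY => ?_))
  · have hZ' := andE₂ (mp (andE₁ (hG Z)).m hZ)
    refine closedI (andE₁ hZ') (stepI fun a b => impI' fun hab => ?_)
    have h := mp (hV a b).m hab
    have h' : _ ⊩ pairMem a b R ⟹ isSub a Z ⟹ bex b (mem 0 (Z + 1)) :=
      ballE (ballE (andE₂ hZ').m (andE₁ h)) (andE₂ h)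
    exact mp h' hab
  · have hY : _ ⊩ isClosed Y R X := hY
    -- The class is `{Z ∈ K : Z ⊆ Y}`. Totality holds since the union of earlier values stays inside
    -- `Y` and `K` is a supply for it.
    refine exists_wchoice (mem 0 (K + 1) ⋏ isSub 0 (Y + 1))
      (all (isImUnion 0 2 ⟹ isStep 0 3 (R + 4))) hf.m hW.m
      (fun α F r => impI' fun hα => impI' fun hF => impI' fun hr => ?_) fun h θ₂ hh hh' => ?_
    · have hr' := into_fun (b := K) hr fun x y => impI' fun hxy => andE₁ (into_app hr.m hxy)
      refine exists_imUnion r fun U _ hU => ?_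
      refine supplyE (mp (mp (mp (mp (hK α F r U).m hα.m) hF.m) hr'.m) hU) hY.m
        (imUnion_subI hU fun y z => impI' fun hyz => andE₂ (into_app hr.m hyz)) fun Z _ h₁ h₂ h₃ => ?_
      exact exI Z (andI (andI h₁ h₂) (allI' fun U' => impI' fun hU' =>
        (imUnion_unique hU.m hU').subst (isStep 0 (Z + 1) (R + 1)) h₃.m))
    · have hfun := into_fun (b := K) hh fun x y => impI' fun hxy => andE₁ (into_app hh.m hxy)
      refine bexE (mp (hS h).m (mp (hE h).m hfun)) fun Z θ₃ hZS hZ => ?_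
      have hZ : θ₃ :: _ ⊩ isImUnion Z h := hZ
      have hZY := imUnion_subI (a := Y) hZ fun y z => impI' fun hyz =>
        andE₂ (into_app hh.m hyz)
      have hstep := wtype_union_closed (R := R) hf.m hW.m (fun a b => (hR a b).m) hfun.m hZ
        fun a u w v y U => impI' fun h₁ => impI' fun h₂ => impI' fun h₃ => impI' fun h₄ =>
          mp (φ := isImUnion U v) (allE U (mp (mp (mp (hh' a u w v y).m h₁.m) h₂.m) h₃.m)) h₄
      refine bexI (mp (andE₂ (hG Z)).m (andI hZS (andI (sub_trans hZY (closed_sub hY.m))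
        (ballI fun a _ => ballI fun b _ => ?_)))) hZY
      exact allE b (allE a hstep.m)

/-- Adding the axiom `x` to a set of rules. -/
theorem exists_insert_axiom (R x : ℕ) (k : ∀ R' Δ, Step Γ Δ →
    (∀ a b, Δ ⊩ pairMem a b R ⟹ pairMem a b R') →
    (∀ Z, Δ ⊩ isStep Z Z R' ⟹ mem x Z) →
    (∀ Z, Δ ⊩ isStep Z Z R ⟹ mem x Z ⟹ isStep Z Z R') → (Δ ⊩ χ)) : Γ ⊩ χ := by
  -- With `o = ∅` and `u = {x}`, the added rule is `⟨o, u⟩`: its premise always holds, so closed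
  -- sets must contain `x`.
  refine exists_sep bot .bot x fun o _ ho => exists_upair x x fun u _ hu => ?_
  refine exists_opair o u fun p _ hp => exists_upair p p fun P _ hP => ?_
  refine exists_upair R P fun Q _ hQ => exists_union Q fun R' θ hR' => k R' _ .of
    (fun a b => impI' fun hab => ?_) (fun Z => impI' fun hZ => ?_)
    (fun Z => impI' fun hZ => impI' fun hx => stepI fun a b => impI' fun hab => impI' fun ha => ?_)
  · exact pairMemE hab fun r _ hr hrab =>
      pairMemI (mp (andE₂ (hR' r)).m (bexI (upair_left hQ.m) hr)) hrab
  · refine stepE hZ (pairMemI (mp (andE₂ (hR' p)).m (bexI (upair_right hQ.m) (upair_left hP.m)))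
      hp.m) (subI fun y hy => botE (andE₂ (mp (andE₁ (ho y)).m hy))) fun y _ hy hyZ => ?_
    exact (single_mem hu.m hy).mem_left hyZ
  · refine pairMemE hab.m fun r _ hr hrab => bexE (mp (andE₁ (hR' r)).m hr) fun Q' _ hQ' hrQ => ?_
    refine orE' (upair_mem hQ.m hQ') (fun e => ?_) fun e => ?_
    · exact stepE hZ.m (pairMemI (e.mem_right hrQ.m) hrab.m) ha.m fun y _ hy hyZ => bexI hy hyZ
    · have h := opair_congr hrab.m (single_mem hP.m (e.mem_right hrQ.m))
      exact bexI ((opair_snd hp.m h).mem_right (upair_left hu.m)) hx.m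

/-- For each `x ∈ X` there is a coinitial set of closed sets containing `x`. The second half of
Strong Collection ensures that only such sets are collected, so every member of their union `G` is
closed. -/
theorem setGenerated (R X : ℕ) :
    Γ ⊩ ex (ball 0 (isClosed 0 (R + 2) (X + 2)) ⋏
      all (isClosed 0 (R + 2) (X + 2) ⟹ ball 0 (bex 2 (mem 1 0 ⋏ isSub 0 2)))) := by
  refine exists_collection (ball 1 (isClosed 0 (R + 3) (X + 3) ⋏ mem 1 0) ⋏
    all (isClosed 0 (R + 3) (X + 3) ⟹ mem 1 0 ⟹ bex 2 (isSub 0 1))) X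
    (fun x => impI' fun _ => ?_) fun S θ h₁ h₂ => exists_union S fun G θ₁ hG => exI G (andI ?_ ?_)
  · refine exists_insert_axiom R x fun R' Δ _ hR hx hR' =>
      exE₂ (ex_coinitial R' X) fun G θ hG hG' => exI G (andI (ballI fun Z hZ => ?_)
        (allI' fun Y => impI' fun (hY : _ ⊩ isClosed Y R X) => impI' fun
          (hxY : _ ⊩ mem x Y) => ?_))
    · have h : mem Z G :: θ :: Δ ⊩ isClosed Z R' X := ballE hG.m hZ
      have hZ' : _ ⊩ isClosed Z R X := closedI (closed_sub h) (stepI fun a b => impI' fun hab =>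
        impI' fun ha => stepE (closed_step h.m) (mp (hR a b).m hab.m) ha fun y _ hy hyZ =>
          bexI hy hyZ)
      exact andI hZ' (mp (hx Z).m (closed_step h))
    · exact mp (φ := isClosed Y R' X) (allE Y hG'.m) (closedI (closed_sub hY.m)
        (mp (mp (hR' Y).m (closed_step hY.m)) hxY))
  · refine ballI fun Z hZ => bexE (mp (andE₁ (hG Z)).m hZ) fun H _ hH hZH =>
      bexE (mp (h₂ H).m hH) fun x _ _ h => ?_
    have h' : _ ⊩ isClosed Z R X ⋏ mem x Z := ballE (andE₁ h) hZH.m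
    exact andE₁ h'
  · refine allI' fun Y => impI' fun (hY : _ ⊩ isClosed Y R X) => ballI fun x hx => ?_
    refine bexE (mp (h₁ x).m (subE (closed_sub hY.m) hx)) fun H _ hH h => ?_
    have h' : _ ⊩ isClosed Y R X ⟹ mem x Y ⟹ bex H (isSub 0 (Y + 1)) := allE Y (andE₂ h)
    refine bexE (mp (mp h' hY.m) hx.m) fun Z _ hZ hZY => ?_
    have hxZ : _ ⊩ isClosed Z R X ⋏ mem x Z := ballE (andE₁ h).m hZ
    exact bexI (mp (andE₂ (hG Z)).m (bexI hH.m hZ)) (andI (andE₂ hxZ) hZY)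

end CZF

theorem mainTheorem2 : CZF.Prov CZF.CZFPlusPAPlusRDCW [] CZF.nid := by
  exact CZF.Prov.allI' fun X => CZF.Prov.allI' fun R => CZF.Prov.impI' fun _ =>
    CZF.setGenerated R X
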